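/- Let $p$ be a prime, $a\ge 1$, $q=p^a$. For $i\ge 0$ let $f_i(x)=\sum_u a_{iu}x^u\in\mathbb{F}_q[x]$ be a polynomial of degree $d_i$ (with $d_i=0$ if $f_i$ is constant or zero), and assume that $d_0>0$ and that the sequence $(d_i)_{i\ge 0}$ is bounded. Write $\mathbb{Z}_{p^r}=W(\mathbb{F}_{p^r})$ for the ring of integers of the unramified extension $\mathbb{Q}_{p^r}$ of $\mathbb{Q}_p$ of degree $r$, let $\hat{\ }$ denote the Teichmüller lift, and put $$\hat f(x)=\sum_{i\ge 0}p^i\sum_{u}\widehat{a_{iu}}\,x^u\in\mathbb{Z}_q[x].$$ For $k\ge 1$ let $\mu_{q^k-1}\subset\mathbb{Z}_{q^k}$ be the group of $(q^k-1)$-th roots of unity, and define $$S_f(T,k)=\sum_{x\in\mu_{q^k-1}}(1+T)^{\mathrm{Tr}_{\mathbb{Q}_{q^k}/\mathbb{Q}_p}(\hat f(x))}\in\mathbb{Z}_p[[T]],\qquad (1+T)^z=\sum_{j\ge 0}\binom{z}{j}T^j\ \ (z\in\mathbb{Z}_p),$$ $$C_f(T,s)=\exp\Big(-\sum_{k\ge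 1}\frac{1}{q^k-1}S_f(T,k)\frac{s^k}{k}\Big)\in\mathbb{Q}_p[[T]][[s]].$$ Let $\delta=\max_{i\ge 0} d_i/p^i$, and let $\widetilde m$ be one plus the first index $i$ with $d_i=\max_{j\ge 0}d_j$. If $\widetilde m=1$, let $\mathrm{ord}_R$ be the $T$-adic order on $\mathbb{Z}_p[[T]]$. If $\widetilde m\ge 2$, put $\theta=\frac{1}{p^{\widetilde m-2}(p-1)}$ and let $\mathrm{ord}_R(b)$, for $b\in\mathbb{Z}_p[[T]]$, be the $(p^\theta,T)$-adic order of $b$, that is, the supremum of all integers $m\ge 0$ such that $b$ lies in the $m$-th power of the ideal $(p^\theta,T)$ of $\mathbb{Z}_p[p^\theta][[T]]$. Then $C_f(T,s)=\sum_{n\ge 0}b_{f,n}(T)s^n$ with $b_{f,n}(T)\in\mathbb{Z}_p[[T]]$, and for every $n\ge 0$ $$\mathrm{ord}_R(b_{f,n}(T))\ \ge\ \frac{a(p-1)n(n-1)}{2\delta}.$$ -/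

import Mathlib

open scoped ENNReal PowerSeries

noncomputable section

namespace WittTower

/-- The Witt vector `(c₀, c₁ ^ p, c₂ ^ p², …)`, which over a perfect ring of characteristic `p` is
the `p`-adically convergent series `∑ i, p ^ i * [c i]` of Teichmüller representatives; see
`pow_dvd_teichmullerSeries_sub_sum`. -/
def teichmullerSeries (p : ℕ) [Fact p.Prime] {K : Type*} [CommRing K] (c : ℕ → K) :
    WittVector p K :=
  WittVector.mk p fun i => c i ^ p ^ i

/-- `teichmullerSeries p c` is the `p`-adic limit of the partial sums of `∑ i, p ^ i * [c i]`. -/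
theorem pow_dvd_teichmullerSeries_sub_sum (p : ℕ) [Fact p.Prime] {K : Type*} [CommRing K]
    [CharP K p] [PerfectRing K p] (c : ℕ → K) (m : ℕ) :
    (p : WittVector p K) ^ m ∣ teichmullerSeries p c -
      ∑ i ∈ Finset.range m, (p : WittVector p K) ^ i * WittVector.teichmuller p (c i) := by
  rcases m with _ | n
  · simp
  · have h := WittVector.dvd_sub_sum_teichmuller_iterateFrobeniusEquiv_coeff
      (teichmullerSeries p c) n
    convert h using 2
    rw [Nat.range_succ_eq_Iic]
    refine Finset.sum_congr rfl fun i _ => ?_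
    rw [mul_comm]
    congr 2
    have h2 : ∀ (j : ℕ) (y : K), ((frobeniusEquiv K p).symm ^ j) (y ^ p ^ j) = y := by
      intro j
      induction j with
      | zero => intro y; simp
      | succ j ih =>
        intro y
        rw [pow_succ', RingAut.mul_apply, pow_succ p j, mul_comm, pow_mul, ih,
          RingEquiv.symm_apply_eq, frobeniusEquiv_apply, frobenius_def]
    exact (h2 i (c i)).symm

/-- `D = max d_i`, where `d_i` is the degree of `f_i` (and `d_i = 0` for a constant `f_i`). -/
def maxDegree {F : Type*} [Field F] (f : ℕ → Polynomial F) : ℕ :=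
  ⨆ i, (f i).natDegree

/-- `δ = max (d_i / p ^ i)`. -/
def delta (p : ℕ) {F : Type*} [Field F] (f : ℕ → Polynomial F) : ℝ :=
  ⨆ i : ℕ, ((f i).natDegree : ℝ) / (p : ℝ) ^ i

/-- One plus the first index `i` with `d_i = D`. -/
def mTilde {F : Type*} [Field F] (f : ℕ → Polynomial F) : ℕ :=
  1 + sInf {i | (f i).natDegree = maxDegree f}

/-- The polynomial `∑ i, p ^ i * f̂_i` over `ℤ_q = W(F)`, where `f̂_i` is obtained from `f_i` by
taking the Teichmüller representative of every coefficient. -/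
def fHat (p : ℕ) [Fact p.Prime] {F : Type*} [Field F] (f : ℕ → Polynomial F) :
    Polynomial (WittVector p F) :=
  ∑ u ∈ Finset.range (maxDegree f + 1),
    Polynomial.monomial u (teichmullerSeries p fun i => (f i).coeff u)

/-- The ring homomorphism `ℤ_p = W(𝔽_p) → W(K)` for a field `K` of characteristic `p`. -/
def padicIntToWitt (p : ℕ) [Fact p.Prime] (K : Type*) [Field K] [CharP K p] :
    ℤ_[p] →+* WittVector p K :=
  (WittVector.map (ZMod.castHom (dvd_refl p) K)).comp
    (WittVector.equiv p).symm.toRingHom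

/-- The trace from `W(K)` to `ℤ_p`; for `K` finite this is the restriction to the integers of the
trace of the unramified extension of `ℚ_p` with residue field `K`. -/
def wittTrace (p : ℕ) [Fact p.Prime] (K : Type*) [Field K] [CharP K p] (z : WittVector p K) :
    ℤ_[p] :=
  letI : Algebra ℤ_[p] (WittVector p K) := (padicIntToWitt p K).toAlgebra
  Algebra.trace ℤ_[p] (WittVector p K) z

instance charP_extension (p : ℕ) [Fact p.Prime] (F : Type*) [Field F] [Finite F] [CharP F p]
    (k : ℕ) [NeZero k] : CharP (FiniteField.Extension F p k) p :=
  charP_of_injective_algebraMap (algebraMap F (FiniteField.Extension F p k)).injective p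

/-- The `T`-adic exponential sum
`S_f(T, k) = ∑_{x ∈ μ_{q ^ k - 1}} (1 + T) ^ Tr(f̂(x))`, where `x` runs over the `(q ^ k - 1)`-th
roots of unity in `ℤ_{q ^ k} = W(𝔽_{q ^ k})`, the trace goes down to `ℤ_p`, and `q = #F`. -/
def expSum (p : ℕ) [Fact p.Prime] {F : Type*} [Field F] [Finite F] [CharP F p]
    (f : ℕ → Polynomial F) (k : ℕ) [NeZero k] : ℤ_[p]⟦X⟧ :=
  ∑ x ∈ Polynomial.nthRootsFinset (Nat.card F ^ k - 1)
      (1 : WittVector p (FiniteField.Extension F p k)),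
    PowerSeries.binomialSeries ℤ_[p]
      (wittTrace p (FiniteField.Extension F p k)
        ((fHat p f).eval₂ (WittVector.map (algebraMap F (FiniteField.Extension F p k))) x))

/-- The exponent `- ∑_{k ≥ 1} (q ^ k - 1)⁻¹ S_f(T, k) s ^ k / k`, a power series in `s` over
`ℚ_p⟦T⟧`. -/
def logCharSeries (p : ℕ) [Fact p.Prime] {F : Type*} [Field F] [Finite F] [CharP F p]
    (f : ℕ → Polynomial F) : ℚ_[p]⟦X⟧⟦X⟧ :=
  PowerSeries.mk fun
    | 0 => 0
    | k + 1 => -((((Nat.card F : ℚ_[p]) ^ (k + 1) - 1) * ((k + 1 : ℕ) : ℚ_[p]))⁻¹ •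
        PowerSeries.map (algebraMap ℤ_[p] ℚ_[p]) (expSum p f (k + 1)))

/-- `C_f(T, s) = exp (- ∑_{k ≥ 1} (q ^ k - 1)⁻¹ S_f(T, k) s ^ k / k)`; the outer power series
variable is `s`, the inner one is `T`. -/
def charSeries (p : ℕ) [Fact p.Prime] {F : Type*} [Field F] [Finite F] [CharP F p]
    (f : ℕ → Polynomial F) : ℚ_[p]⟦X⟧⟦X⟧ :=
  (PowerSeries.exp ℚ).subst (logCharSeries p f)

/-- The `I`-adic order of `x`: the supremum of all `m` with `x ∈ I ^ m`. -/
def adicOrder {A : Type*} [CommRing A] (I : Ideal A) (x : A) : ℕ∞ :=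
  ⨆ (m : ℕ) (_ : x ∈ I ^ m), (m : ℕ∞)

/-- For `θ = 1 / N`, the ring `ℤ_p[p ^ θ] = ℤ_p[Y] / (Y ^ N - p)`. -/
abbrev PadicIntRoot (p : ℕ) [Fact p.Prime] (N : ℕ) : Type :=
  AdjoinRoot (Polynomial.X ^ N - Polynomial.C (p : ℤ_[p]))

/-- The `R`-order on `ℤ_p⟦T⟧` belonging to the level `m = m̃ ≥ 1`. For `m = 1` it is the `T`-adic
order. For `m ≥ 2` put `θ = 1 / (p ^ (m - 2) * (p - 1))`; then it is the order with respect to the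
ideal `(p ^ θ, T)` of `ℤ_p[p ^ θ]⟦T⟧`. -/
def ordR (p : ℕ) [Fact p.Prime] (m : ℕ) (b : ℤ_[p]⟦X⟧) : ℕ∞ :=
  if m = 1 then adicOrder (Ideal.span {(PowerSeries.X : ℤ_[p]⟦X⟧)}) b
  else
    adicOrder
      (Ideal.span {PowerSeries.C (AdjoinRoot.root
          (Polynomial.X ^ (p ^ (m - 2) * (p - 1)) - Polynomial.C (p : ℤ_[p]))),
        (PowerSeries.X : (PadicIntRoot p (p ^ (m - 2) * (p - 1)))⟦X⟧)})
      (PowerSeries.map (algebraMap ℤ_[p] (PadicIntRoot p (p ^ (m - 2) * (p - 1)))) b)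

end WittTower

end

/-! The series `C_f` is the determinant `det(1 - sB)` of a Dwork operator, and its Newton polygon is
bounded below by the Hodge polygon read off from the matrix entries.

Splitting. Let `v` be the `p`-adic valuation. The series `G(X, t) = exp(∑_{m ≥ 1} X^(p^v(m)) t^m /
m)` is integral by Dwork's criterion, and its coefficient of `t^n` has degree at most `n` in `X`
(`exists_splittingFunction`). If `y^(p^r) = y`, then `∑_{j<r} (y^(p^j))^(p^v)` does not depend on
`v`, so `∏_{j<r} G(y^(p^j), t) = (1 - t)^(-Tr y)`. At `t = 1 - (1+T)^(-p^i)` this is `(1+T)^(p^i Tr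
y)`. Multiplying over the monomials of all `f_i` writes `(1+T)^Tr(f̂(x))` as a product of conjugate
values `P_j(x^(p^j))`, and Dwork's trace formula gives `S_f(T, k) = (q^k - 1) Tr(B^k)`, where `B` is
the product of the `a` matrices of `ψ_p ∘ P_j` (`X_pow_dvd_trace_sub_polyExpSum`).

Estimate. Let `T` have weight `1` and `p` weight `p^(m̃-2)(p-1)`; for `m̃ = 1` only powers of `T`
count. The parameter of level `i` then has weight at least `p^min(i, m̃-1)` (`param_mem_filt`), and
`d_i ≤ δ p^min(i, m̃-1)` because the maximal degree is attained at index `m̃-1`. Hence the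
coefficient of `X^w` in `P_j` has weight at least `w/δ`, and the entry `(u, v)` of each matrix has
weight at least `(pu - v)/δ`. In a principal `n × n` minor of the product each of the `a` factors
contributes at least `(p-1)(0 + 1 + ⋯ + (n-1))/δ` (`coeff_charpolyRev_matProd_mem_filt`).

Identities between exponentials are proved by comparing logarithmic derivatives. The operators are
cut down modulo `T^M` to finite matrices. The coefficients descend from `W(F)` to `ℤ_p`, and the
infinite sum `f̂` is reached as a limit of partial sums, using that `ℤ_p` is compact. -/

namespace WittTower

/-! ### Logarithmic derivatives of power series -/

section LogDeriv

variable {R : Type*} [CommRing R]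

/-- A power series over a torsion-free ring is determined by its constant coefficient and its
logarithmic derivative. -/
theorem eq_of_derivative_eq_mul [IsAddTorsionFree R] {g h l : R⟦X⟧}
    (hg : d⁄dX R g = l * g) (hh : d⁄dX R h = l * h)
    (h0 : PowerSeries.constantCoeff g = PowerSeries.constantCoeff h) : g = h := by
  ext n
  induction n using Nat.strong_induction_on with
  | _ n ih =>
    rcases n with _ | n
    · simpa using h0
    · have h1 := congrArg (PowerSeries.coeff n) hg
      have h2 := congrArg (PowerSeries.coeff n) hh
      rw [PowerSeries.coeff_derivative, PowerSeries.coeff_mul] at h1 h2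
      have h3 : PowerSeries.coeff (n + 1) g * (n + 1) = PowerSeries.coeff (n + 1) h * (n + 1) := by
        rw [h1, h2]
        refine Finset.sum_congr rfl fun ij hij => ?_
        rw [ih ij.2 (by have := Finset.HasAntidiagonal.mem_antidiagonal.1 hij; omega)]
      have h4 : (n + 1) • PowerSeries.coeff (n + 1) g = (n + 1) • PowerSeries.coeff (n + 1) h := by
        simpa [nsmul_eq_mul, mul_comm] using h3
      exact nsmul_right_injective (Nat.succ_ne_zero n) h4

theorem derivative_mul_of_logDeriv {g h l m : R⟦X⟧}
    (hg : d⁄dX R g = l * g) (hh : d⁄dX R h = m * h) : d⁄dX R (g * h) = (l + m) * (g * h) := by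
  rw [Derivation.leibniz, hg, hh, smul_eq_mul, smul_eq_mul]
  ring

theorem derivative_prod_of_logDeriv {ι : Type*} (s : Finset ι) {g l : ι → R⟦X⟧}
    (h : ∀ i ∈ s, d⁄dX R (g i) = l i * g i) :
    d⁄dX R (∏ i ∈ s, g i) = (∑ i ∈ s, l i) * ∏ i ∈ s, g i := by
  classical
  induction s using Finset.induction_on with
  | empty => simp
  | insert a s ha ih =>
    rw [Finset.prod_insert ha, Finset.sum_insert ha]
    exact derivative_mul_of_logDeriv (h a (Finset.mem_insert_self _ _))
      (ih fun i hi => h i (Finset.mem_insert_of_mem hi))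

theorem derivative_map {S : Type*} [CommRing S] (φ : R →+* S) (g : R⟦X⟧) :
    d⁄dX S (PowerSeries.map φ g) = PowerSeries.map φ (d⁄dX R g) := by
  ext n
  simp [PowerSeries.coeff_derivative]

/-- Over a `ℚ`-algebra every logarithmic derivative is attained. -/
theorem exists_derivative_eq_mul [Algebra ℚ R] (l : R⟦X⟧) :
    ∃ g : R⟦X⟧, PowerSeries.constantCoeff g = 1 ∧ d⁄dX R g = l * g := by
  let L : R⟦X⟧ := PowerSeries.mk fun
    | 0 => 0
    | n + 1 => algebraMap ℚ R (1 / (n + 1)) * PowerSeries.coeff n l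
  have hL0 : PowerSeries.constantCoeff L = 0 := by
    rw [← PowerSeries.coeff_zero_eq_constantCoeff_apply, PowerSeries.coeff_mk]
  have hL : PowerSeries.HasSubst L := PowerSeries.HasSubst.of_constantCoeff_zero' hL0
  have hdL : d⁄dX R L = l := by
    ext n
    rw [PowerSeries.coeff_derivative, PowerSeries.coeff_mk]
    have : algebraMap ℚ R (1 / (n + 1)) * (n + 1) = 1 := by
      have h : ((n : R) + 1) = algebraMap ℚ R (n + 1) := by simp
      rw [h, ← map_mul, one_div, inv_mul_cancel₀ (by positivity), map_one]
    linear_combination PowerSeries.coeff n l * this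
  refine ⟨(PowerSeries.exp R).subst L, ?_, ?_⟩
  · rw [← PowerSeries.coeff_zero_eq_constantCoeff_apply, PowerSeries.coeff_subst' hL,
      finsum_eq_single _ 0]
    · simp
    · intro n hn
      simp [hL0, hn]
  · rw [PowerSeries.derivative_subst hL, PowerSeries.derivative_exp, hdL, mul_comm]

end LogDeriv

/-! ### Dwork's integrality criterion and the splitting function -/

section Dwork

variable (p : ℕ) {A : Type*} [CommRing A]

/-- The series `∑ n, x ^ (p ^ v_p(n + 1)) t ^ n`. -/
noncomputable def splittingLogDeriv (x : A) : A⟦X⟧ :=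
  PowerSeries.mk fun n => x ^ p ^ padicValNat p (n + 1)

theorem map_splittingLogDeriv {B : Type*} [CommRing B] (φ : A →+* B) (x : A) :
    PowerSeries.map φ (splittingLogDeriv p x) = splittingLogDeriv p (φ x) := by
  ext n
  simp [splittingLogDeriv]

variable [hp : Fact p.Prime]

/-- The extension of an endomorphism `φ` of `A` to `A⟦t⟧` with `t ↦ t ^ p`. -/
noncomputable def frobeniusLift (φ : A →+* A) : A⟦X⟧ →+* A⟦X⟧ :=
  (PowerSeries.expand p hp.out.ne_zero).toRingHom.comp (PowerSeries.map φ)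

theorem coeff_frobeniusLift (φ : A →+* A) (g : A⟦X⟧) (n : ℕ) :
    PowerSeries.coeff n (frobeniusLift p φ g) =
      if p ∣ n then φ (PowerSeries.coeff (n / p) g) else 0 := by
  simp [frobeniusLift, PowerSeries.coeff_expand]

theorem map_frobeniusLift {B : Type*} [CommRing B] (ι : A →+* B) {φ : A →+* A} {ψ : B →+* B}
    (h : ∀ x, ι (φ x) = ψ (ι x)) (g : A⟦X⟧) :
    PowerSeries.map ι (frobeniusLift p φ g) = frobeniusLift p ψ (PowerSeries.map ι g) := by
  ext1 n
  rw [PowerSeries.coeff_map, coeff_frobeniusLift, coeff_frobeniusLift, PowerSeries.coeff_map]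
  split_ifs
  · exact h _
  · simp

theorem derivative_frobeniusLift (φ : A →+* A) (g : A⟦X⟧) :
    d⁄dX A (frobeniusLift p φ g) =
      (p : A⟦X⟧) * PowerSeries.X ^ (p - 1) * frobeniusLift p φ (d⁄dX A g) := by
  have h : ∀ g : A⟦X⟧, frobeniusLift p φ g =
      (PowerSeries.map φ g).subst (PowerSeries.X ^ p : A⟦X⟧) := fun g => by
    rw [← PowerSeries.expand_apply p hp.out.ne_zero]; rfl
  rw [h, h, PowerSeries.derivative_subst (PowerSeries.HasSubst.X_pow hp.out.ne_zero),
    derivative_map, PowerSeries.derivative_pow, PowerSeries.derivative_X]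
  ring

/-- If `φ` lifts the Frobenius, then `Φ g ≡ g ^ p` modulo `p`. -/
theorem dvd_coeff_frobeniusLift_sub_pow {k : Type*} [CommRing k] [CharP k p] (π : A →+* k)
    (hπ : ∀ a, π a = 0 → (p : A) ∣ a) {φ : A →+* A} (hφ : ∀ a, π (φ a) = π a ^ p)
    (g : A⟦X⟧) (n : ℕ) :
    (p : A) ∣ PowerSeries.coeff n (frobeniusLift p φ g - g ^ p) := by
  apply hπ
  have : ExpChar k p := .prime hp.out
  have h1 : PowerSeries.map π (frobeniusLift p φ g) =
      frobeniusLift p (frobenius k p) (PowerSeries.map π g) :=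
    map_frobeniusLift p π hφ g
  have h2 : frobeniusLift p (frobenius k p) (PowerSeries.map π g) = (PowerSeries.map π g) ^ p := by
    rw [frobeniusLift]
    refine Eq.trans ?_ (MvPowerSeries.map_frobenius_expand p hp.out.ne_zero
      (f := (PowerSeries.map π g : k⟦X⟧)))
    exact (PowerSeries.map_expand p hp.out.ne_zero (frobenius k p) (PowerSeries.map π g)).symm
  rw [← PowerSeries.coeff_map, map_sub, map_pow, h1, h2, sub_self, map_zero]

/-- Dwork's integrality criterion. -/
theorem coeff_mem_range_of_frobeniusLift_eq {B k : Type*} [CommRing B] [IsAddTorsionFree B]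
    [CommRing k] [CharP k p] (ι : A →+* B) (π : A →+* k)
    (hπ : ∀ a, π a = 0 → (p : A) ∣ a) {φ : A →+* A} (hφ : ∀ a, π (φ a) = π a ^ p)
    {ψ : B →+* B} (hψ : ∀ x, ι (φ x) = ψ (ι x)) {G : B⟦X⟧} {V : A⟦X⟧}
    (hG0 : PowerSeries.constantCoeff G = 1)
    (hG : frobeniusLift p ψ G = G ^ p * PowerSeries.map ι (1 + (p : A⟦X⟧) * V)) (n : ℕ) :
    PowerSeries.coeff n G ∈ ι.range := by
  induction n using Nat.strong_induction_on with
  | _ n ih =>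
    rcases n.eq_zero_or_pos with rfl | hn
    · exact ⟨1, by simp [hG0]⟩
    choose! c hc using ih
    -- `ι` need not be injective, so the constant term of the lift is prescribed to be `1` instead
    -- of being taken from `c`.
    let P : A⟦X⟧ := PowerSeries.mk fun m => if m < n then (if m = 0 then 1 else c m) else 0
    have hP : ∀ m < n, PowerSeries.coeff m G = ι (PowerSeries.coeff m P) := by
      intro m hm
      rw [PowerSeries.coeff_mk, if_pos hm]
      split_ifs with h0
      · simp [h0, hG0]
      · exact (hc m hm).symm
    have hP0 : PowerSeries.constantCoeff P = 1 := by
      rw [← PowerSeries.coeff_zero_eq_constantCoeff_apply, PowerSeries.coeff_mk]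
      simp [hn]
    have hPn : PowerSeries.coeff n P = 0 := by simp [P]
    obtain ⟨H, hH⟩ : (PowerSeries.X : B⟦X⟧) ^ n ∣ G - PowerSeries.map ι P := by
      rw [PowerSeries.X_pow_dvd_iff]
      intro m hm
      simp [hP m hm]
    have hH0 : PowerSeries.constantCoeff H = PowerSeries.coeff n G := by
      have := congrArg (PowerSeries.coeff n) hH
      rw [map_sub, PowerSeries.coeff_map, hPn, map_zero, sub_zero, PowerSeries.coeff_X_pow_mul',
        if_pos le_rfl, Nat.sub_self, PowerSeries.coeff_zero_eq_constantCoeff_apply] at this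
      exact this.symm
    obtain ⟨k', hk'⟩ := Polynomial.powAddExpansion (PowerSeries.map ι P)
      ((PowerSeries.X : B⟦X⟧) ^ n * H) p
    -- In degree `n` the correction contributes only `p * H(0)`, because `P(0) = 1` and `n > 0`; and
    -- `H(0)` is the unknown coefficient of `G`.
    have hGp : G ^ p = PowerSeries.map ι (P ^ p) + (PowerSeries.X : B⟦X⟧) ^ n *
        ((p : B⟦X⟧) * (PowerSeries.map ι P) ^ (p - 1) * H + PowerSeries.X ^ n * (k' * H ^ 2)) := by
      rw [← hH, add_sub_cancel, hH] at hk'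
      rw [hk', map_pow]
      ring
    have e1 : PowerSeries.coeff n (G ^ p * PowerSeries.map ι (1 + (p : A⟦X⟧) * V)) =
        ι (PowerSeries.coeff n (P ^ p * (1 + (p : A⟦X⟧) * V))) + p * PowerSeries.coeff n G := by
      rw [hGp, add_mul, ← map_mul, map_add, PowerSeries.coeff_map, mul_assoc,
        PowerSeries.coeff_X_pow_mul', if_pos le_rfl, Nat.sub_self,
        PowerSeries.coeff_zero_eq_constantCoeff_apply]
      congr 1
      have h3 : PowerSeries.constantCoeff (PowerSeries.map ι P) = 1 := by
        rw [← PowerSeries.coeff_zero_eq_constantCoeff_apply, PowerSeries.coeff_map,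
          PowerSeries.coeff_zero_eq_constantCoeff_apply, hP0, map_one]
      have h4 : PowerSeries.constantCoeff (PowerSeries.map ι (1 + (p : A⟦X⟧) * V)) =
          1 + p * ι (PowerSeries.constantCoeff V) := by
        rw [← PowerSeries.coeff_zero_eq_constantCoeff_apply, PowerSeries.coeff_map]
        simp
      have h5 : (p : B) * ι (PowerSeries.constantCoeff V) = 0 := by
        have h6 := congrArg PowerSeries.constantCoeff hG
        rw [map_mul, map_pow, hG0, h4, one_pow, one_mul,
          ← PowerSeries.coeff_zero_eq_constantCoeff_apply, coeff_frobeniusLift] at h6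
        simpa [hG0] using h6
      rw [map_mul, h4, h5]
      simp [h3, hH0, hn.ne']
    have e2 : PowerSeries.coeff n (frobeniusLift p ψ G) =
        ι (PowerSeries.coeff n (frobeniusLift p φ P)) := by
      rw [coeff_frobeniusLift, coeff_frobeniusLift]
      split_ifs with h
      · rw [hψ, hP _ (Nat.div_lt_self hn hp.out.one_lt)]
      · simp
    obtain ⟨r, hr⟩ : (p : A) ∣
        PowerSeries.coeff n (frobeniusLift p φ P - P ^ p * (1 + (p : A⟦X⟧) * V)) := by
      have h7 : frobeniusLift p φ P - P ^ p * (1 + (p : A⟦X⟧) * V) =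
          (frobeniusLift p φ P - P ^ p) - PowerSeries.C (p : A) * (P ^ p * V) := by
        rw [map_natCast]; ring
      rw [h7, map_sub, PowerSeries.coeff_C_mul]
      exact dvd_sub (dvd_coeff_frobeniusLift_sub_pow p π hπ hφ P n) (dvd_mul_right _ _)
    refine ⟨r, ?_⟩
    have h8 := congrArg (PowerSeries.coeff n) hG
    rw [e1, e2] at h8
    have h9 : (p : B) * ι r = p * PowerSeries.coeff n G := by
      rw [← map_natCast ι p, ← map_mul, ← hr, map_sub, map_sub, h8, map_natCast]
      ring
    refine nsmul_right_injective hp.out.ne_zero ?_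
    simpa [nsmul_eq_mul] using h9

theorem isUnit_natCast_of_not_dvd {n : ℕ} (h : ¬ p ∣ n) : IsUnit (n : ℤ_[p]) := by
  by_contra hn
  rw [PadicInt.not_isUnit_iff] at hn
  exact h (by exact_mod_cast (PadicInt.norm_int_lt_one_iff_dvd (p := p) n).1 (by simpa using hn))

/-- The coefficients `p ^ n / n!` of `exp (p t)`: they are integral, and divisible by `p` for
`n ≥ 1`. -/
theorem exists_factorial_mul_eq_pow :
    ∃ w : ℕ → ℤ_[p], w 0 = 1 ∧ ∀ n, (n + 1).factorial * (p * w (n + 1)) = (p : ℤ_[p]) ^ (n + 1) := by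
  have h : ∀ n : ℕ, ∃ w : ℤ_[p], (n + 1).factorial * (p * w) = (p : ℤ_[p]) ^ (n + 1) := by
    intro n
    have hv := padicValNat_factorial_lt_of_ne_zero (p := p) n.succ_ne_zero
    obtain ⟨m, hm⟩ := pow_padicValNat_dvd (p := p) (n := (n + 1).factorial)
    have hmu : IsUnit (m : ℤ_[p]) := by
      refine isUnit_natCast_of_not_dvd p fun ⟨d, hd⟩ => ?_
      refine pow_succ_padicValNat_not_dvd (p := p) (Nat.factorial_ne_zero (n + 1)) ⟨d, ?_⟩
      rw [pow_succ, mul_assoc, ← hd, ← hm]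
    obtain ⟨u, hu⟩ := hmu.exists_right_inv
    -- Here `(n + 1)! = p ^ v * m` with `m` prime to `p` and `v ≤ n`, so `p ^ (n + 1) / (n + 1)! = p
    -- * p ^ (n - v) / m`, and `u` is `1 / m`.
    refine ⟨p ^ (n - padicValNat p (n + 1).factorial) * u, ?_⟩
    have h1 : (p : ℤ_[p]) ^ (n + 1) = p ^ padicValNat p (n + 1).factorial *
        (p * p ^ (n - padicValNat p (n + 1).factorial)) := by
      rw [← pow_succ', ← pow_add]
      congr 1
      rw [Nat.succ_eq_add_one] at hv
      omega
    have h2 : ((n + 1).factorial : ℤ_[p]) = p ^ padicValNat p (n + 1).factorial * m := by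
      exact_mod_cast congrArg (Nat.cast (R := ℤ_[p])) hm
    rw [h1, h2]
    linear_combination (p : ℤ_[p]) ^ padicValNat p (n + 1).factorial * p *
      p ^ (n - padicValNat p (n + 1).factorial) * hu
  choose w hw using h
  exact ⟨fun | 0 => 1 | n + 1 => w n, rfl, hw⟩

/-- For `x` in a `ℤ_p`-algebra, the series `exp (- p x ∑_{p ∤ n} t ^ n / n)` is integral and
congruent to `1` modulo `p`. -/
theorem exists_derivative_eq_neg_p_mul [Algebra ℤ_[p] A] [IsAddTorsionFree A] (x : A) :
    ∃ V : A⟦X⟧, PowerSeries.constantCoeff V = 0 ∧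
      d⁄dX A (1 + (p : A⟦X⟧) * V) =
      (-(p : A⟦X⟧) * PowerSeries.mk fun n => if p ∣ n + 1 then 0 else x) *
        (1 + (p : A⟦X⟧) * V) := by
  obtain ⟨w, hw0, hw⟩ := exists_factorial_mul_eq_pow p
  let c : A⟦X⟧ := PowerSeries.mk fun n =>
    if p ∣ n then 0 else - algebraMap ℤ_[p] A (Ring.inverse (n : ℤ_[p])) * x
  have hc0 : PowerSeries.constantCoeff c = 0 := by
    rw [← PowerSeries.coeff_zero_eq_constantCoeff_apply, PowerSeries.coeff_mk]
    simp
  have hc : PowerSeries.HasSubst c := PowerSeries.HasSubst.of_constantCoeff_zero' hc0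
  have hdc : d⁄dX A c = - PowerSeries.mk fun n => if p ∣ n + 1 then 0 else x := by
    ext n
    rw [PowerSeries.coeff_derivative, PowerSeries.coeff_mk, map_neg, PowerSeries.coeff_mk]
    split_ifs with h
    · simp
    · have hu : IsUnit ((n + 1 : ℕ) : ℤ_[p]) := isUnit_natCast_of_not_dvd p h
      have := congrArg (algebraMap ℤ_[p] A) (Ring.inverse_mul_cancel _ hu)
      rw [map_mul, map_one, map_natCast] at this
      push_cast at this ⊢
      linear_combination -x * this
  -- `1 + p e₁` is `exp (p t)`, so `V` can be taken to be `e₁(c)`, where `p c` is the required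
  -- exponent.
  let e₁ : A⟦X⟧ := PowerSeries.mk fun
    | 0 => 0
    | n + 1 => algebraMap ℤ_[p] A (w (n + 1))
  have he : d⁄dX A (1 + (p : A⟦X⟧) * e₁) = (p : A⟦X⟧) * (1 + (p : A⟦X⟧) * e₁) := by
    have hcoe : ∀ n, n.factorial • PowerSeries.coeff n (1 + (p : A⟦X⟧) * e₁) = (p : A) ^ n := by
      intro n
      rw [← map_natCast (PowerSeries.C (R := A)), map_add, PowerSeries.coeff_C_mul,
        PowerSeries.coeff_mk]
      rcases n with _ | n
      · simp
      · have := congrArg (algebraMap ℤ_[p] A) (hw n)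
        simp only [map_mul, map_natCast, map_pow] at this
        simpa [PowerSeries.coeff_one, nsmul_eq_mul] using this
    ext n
    refine nsmul_right_injective (Nat.factorial_ne_zero n) ?_
    have h1 := hcoe n
    have h2 := hcoe (n + 1)
    simp only
    rw [PowerSeries.coeff_derivative, ← map_natCast (PowerSeries.C (R := A)),
      PowerSeries.coeff_C_mul]
    rw [Nat.factorial_succ] at h2
    simp only [nsmul_eq_mul, map_natCast] at *
    push_cast at h2
    linear_combination h2 - p * h1
  have hs : (1 + (p : A⟦X⟧) * e₁).subst c = 1 + (p : A⟦X⟧) * e₁.subst c := by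
    rw [← PowerSeries.coe_substAlgHom hc]
    simp
  refine ⟨e₁.subst c, ?_, ?_⟩
  · have := PowerSeries.constantCoeff_subst_eq_zero hc0 e₁ (by
      rw [← PowerSeries.coeff_zero_eq_constantCoeff_apply, PowerSeries.coeff_mk])
    exact this
  · rw [← hs, PowerSeries.derivative_subst hc, he, hdc, ← PowerSeries.coe_substAlgHom hc, map_mul,
      map_natCast]
    ring

/-- The splitting function: the series `exp (∑_{m ≥ 1} X ^ (p ^ v_p(m)) t ^ m / m)` has coefficients
in `ℤ_p[X]`, and the coefficient of `t ^ n` has degree at most `n`. -/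
theorem exists_splittingFunction :
    ∃ G : (Polynomial ℤ_[p])⟦X⟧, PowerSeries.constantCoeff G = 1 ∧
      d⁄dX _ G = splittingLogDeriv p (Polynomial.X : Polynomial ℤ_[p]) * G ∧
      ∀ n, (PowerSeries.coeff n G).natDegree ≤ n := by
  let ι : Polynomial ℤ_[p] →+* Polynomial ℚ_[p] := Polynomial.mapRingHom (algebraMap ℤ_[p] ℚ_[p])
  have hι : Function.Injective ι := Polynomial.map_injective _ (IsFractionRing.injective _ _)
  obtain ⟨G, hG0, hG⟩ := exists_derivative_eq_mul
    (splittingLogDeriv p (Polynomial.X : Polynomial ℚ_[p]))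
  obtain ⟨V, hV0, hV⟩ := exists_derivative_eq_neg_p_mul p (Polynomial.X : Polynomial ℤ_[p])
  let φ : Polynomial ℤ_[p] →+* Polynomial ℤ_[p] := (Polynomial.expand ℤ_[p] p).toRingHom
  let ψ : Polynomial ℚ_[p] →+* Polynomial ℚ_[p] := (Polynomial.expand ℚ_[p] p).toRingHom
  let π : Polynomial ℤ_[p] →+* Polynomial (ZMod p) := Polynomial.mapRingHom PadicInt.toZMod
  have hπ : ∀ a, π a = 0 → (p : Polynomial ℤ_[p]) ∣ a := by
    intro a ha
    rw [← map_natCast Polynomial.C, Polynomial.C_dvd_iff_dvd_coeff]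
    intro i
    have h := congrArg (fun f => Polynomial.coeff f i) ha
    simp only [π, Polynomial.coe_mapRingHom, Polynomial.coeff_map, Polynomial.coeff_zero] at h
    rwa [← RingHom.mem_ker, PadicInt.ker_toZMod, PadicInt.maximalIdeal_eq_span_p,
      Ideal.mem_span_singleton] at h
  have hφ : ∀ a, π (φ a) = π a ^ p := by
    intro a
    rw [← ZMod.expand_card]
    exact Polynomial.map_expand
  have hψ : ∀ a, ι (φ a) = ψ (ι a) := fun a => Polynomial.map_expand
  -- The lift sends `X ^ (p ^ v(m)) t ^ m / m` to `p` times the term of index `p m`. So the lift of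
  -- `log G` is `p log G` minus `p` times the terms with `p ∤ m`, and these are what `1 + p V`
  -- accounts for.
  have hfrob : PowerSeries.X ^ (p - 1) *
      frobeniusLift p ψ (splittingLogDeriv p (Polynomial.X : Polynomial ℚ_[p])) =
      splittingLogDeriv p (Polynomial.X : Polynomial ℚ_[p]) -
        PowerSeries.mk fun n => if p ∣ n + 1 then 0 else Polynomial.X := by
    ext1 n
    have hp1 := hp.out.one_lt
    rw [PowerSeries.coeff_X_pow_mul', map_sub, coeff_frobeniusLift, PowerSeries.coeff_mk]
    simp only [splittingLogDeriv, PowerSeries.coeff_mk]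
    by_cases hd : p ∣ n + 1
    · obtain ⟨m, hm⟩ := hd
      obtain ⟨m, rfl⟩ : ∃ m', m = m' + 1 := ⟨m - 1, by
        rcases m with _ | m
        · simp at hm
        · simp⟩
      have hn : n - (p - 1) = p * m := by rw [mul_add] at hm; omega
      have hle : p - 1 ≤ n := by rw [mul_add] at hm; omega
      rw [if_pos hle, hn, if_pos (dvd_mul_right _ _), Nat.mul_div_cancel_left _ hp.out.pos, hm,
        if_pos (dvd_mul_right _ _), sub_zero,
        padicValNat.mul hp.out.ne_zero (Nat.succ_ne_zero m), padicValNat_self, pow_add, pow_one,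
        pow_mul]
      simp [ψ]
    · rw [if_neg hd, padicValNat.eq_zero_of_not_dvd hd, pow_zero, pow_one, sub_self]
      split_ifs with h1 h2
      · exact absurd (by obtain ⟨c, hc⟩ := h2; exact ⟨c + 1, by rw [mul_add]; omega⟩) hd
      · rfl
      · rfl
  have hfun : frobeniusLift p ψ G = G ^ p * PowerSeries.map ι (1 + (p : (Polynomial ℤ_[p])⟦X⟧) * V) := by
    have hV' : d⁄dX _ (PowerSeries.map ι (1 + (p : (Polynomial ℤ_[p])⟦X⟧) * V)) =
        (-(p : (Polynomial ℚ_[p])⟦X⟧) * PowerSeries.mk fun n => if p ∣ n + 1 then 0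
          else Polynomial.X) * PowerSeries.map ι (1 + (p : (Polynomial ℤ_[p])⟦X⟧) * V) := by
      rw [derivative_map, hV, map_mul, map_mul, map_neg, map_natCast]
      congr 2
      ext1 n
      rw [PowerSeries.coeff_map, PowerSeries.coeff_mk, PowerSeries.coeff_mk]
      split_ifs <;> simp [ι]
    have hGp : d⁄dX _ (G ^ p) = (p * splittingLogDeriv p (Polynomial.X : Polynomial ℚ_[p])) *
        G ^ p := by
      rw [PowerSeries.derivative_pow, hG]
      linear_combination (p : (Polynomial ℚ_[p])⟦X⟧) * splittingLogDeriv p Polynomial.X *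
        pow_sub_one_mul hp.out.ne_zero G
    refine eq_of_derivative_eq_mul (l := (p : (Polynomial ℚ_[p])⟦X⟧) * (PowerSeries.X ^ (p - 1) *
      frobeniusLift p ψ (splittingLogDeriv p (Polynomial.X : Polynomial ℚ_[p])))) ?_ ?_ ?_
    · rw [derivative_frobeniusLift, hG, map_mul]
      ring
    · rw [derivative_mul_of_logDeriv hGp hV', hfrob]
      ring
    · have h1 : PowerSeries.constantCoeff (PowerSeries.map ι V) = 0 := by
        rw [← PowerSeries.coeff_zero_eq_constantCoeff_apply, PowerSeries.coeff_map,
          PowerSeries.coeff_zero_eq_constantCoeff_apply, hV0, map_zero]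
      rw [← PowerSeries.coeff_zero_eq_constantCoeff_apply, coeff_frobeniusLift]
      simp [hG0, h1]
  have hmem := coeff_mem_range_of_frobeniusLift_eq p ι π hπ hφ hψ hG0 hfun
  choose g hg using hmem
  have hmap : PowerSeries.map ι (PowerSeries.mk g) = G := by
    ext1 n
    simp [hg]
  have hder : d⁄dX _ (PowerSeries.mk g) =
      splittingLogDeriv p (Polynomial.X : Polynomial ℤ_[p]) * PowerSeries.mk g := by
    apply PowerSeries.map_injective ι hι
    rw [← derivative_map, map_mul, map_splittingLogDeriv, hmap, hG]
    simp [ι]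
  have h0 : g 0 = 1 := hι (by rw [hg]; simp [hG0])
  refine ⟨PowerSeries.mk g, ?_, hder, fun n => ?_⟩
  · rw [← PowerSeries.coeff_zero_eq_constantCoeff_apply, PowerSeries.coeff_mk, h0]
  · induction n using Nat.strong_induction_on with
    | _ n ih =>
      rcases n with _ | n
      · simp [h0]
      -- The degree bound comes from the recursion `(n + 1) G_{n+1} = ∑_{i+j=n} X ^ (p ^ v(i+1))
      -- G_j`, as `p ^ v(i+1) ≤ i + 1`.
      · have h1 := congrArg (PowerSeries.coeff n) hder
        rw [PowerSeries.coeff_derivative, PowerSeries.coeff_mul] at h1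
        have h2 : (PowerSeries.coeff (n + 1) (PowerSeries.mk g) * ((n : Polynomial ℤ_[p]) + 1)).natDegree =
            (PowerSeries.coeff (n + 1) (PowerSeries.mk g)).natDegree := by
          rw [← Nat.cast_succ, mul_comm, ← map_natCast Polynomial.C, Polynomial.natDegree_C_mul]
          exact_mod_cast n.succ_ne_zero
        rw [← h2, h1]
        refine Polynomial.natDegree_sum_le_of_forall_le _ _ fun ij hij => ?_
        have hij' := Finset.HasAntidiagonal.mem_antidiagonal.1 hij
        refine Polynomial.natDegree_mul_le.trans ?_
        have h3 := ih ij.2 (by omega)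
        have h4 : (PowerSeries.coeff ij.1
            (splittingLogDeriv p (Polynomial.X : Polynomial ℤ_[p]))).natDegree ≤ ij.1 + 1 := by
          rw [splittingLogDeriv, PowerSeries.coeff_mk]
          refine (Polynomial.natDegree_X_pow_le _).trans (Nat.le_of_dvd (by omega) ?_)
          exact pow_padicValNat_dvd
        omega

end Dwork

/-! ### The weight filtration -/

theorem ceilDiv_le_ceilDiv_of_le (N : ℕ) {a b : ℕ} (h : a ≤ b) : a ⌈/⌉ N ≤ b ⌈/⌉ N := by
  rw [Nat.ceilDiv_eq_add_pred_div, Nat.ceilDiv_eq_add_pred_div]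
  exact Nat.div_le_div_right (by omega)

section Filtration

variable {A : Type*} [CommRing A]

/-- The ideal of series `∑ b_j T ^ j` such that `c ^ ⌈(K - j) / N⌉` divides `b_j` for all `j`. -/
def filt (A : Type*) [CommRing A] (c N : ℕ) (K : ℕ) : Ideal A⟦X⟧ where
  carrier := {b | ∀ j, (c : A) ^ ((K - j) ⌈/⌉ N) ∣ PowerSeries.coeff j b}
  add_mem' ha hb j := by rw [map_add]; exact dvd_add (ha j) (hb j)
  zero_mem' j := by simp
  smul_mem' a b hb j := by
    rw [smul_eq_mul, PowerSeries.coeff_mul]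
    refine Finset.dvd_sum fun ij hij => Dvd.dvd.mul_left ((pow_dvd_pow _ ?_).trans (hb ij.2)) _
    have := Finset.HasAntidiagonal.mem_antidiagonal.1 hij
    exact ceilDiv_le_ceilDiv_of_le N (by omega)

variable {c N : ℕ}

theorem filt_anti {K L : ℕ} (h : K ≤ L) : filt A c N L ≤ filt A c N K := fun _ hb j =>
  (pow_dvd_pow _ (ceilDiv_le_ceilDiv_of_le N (by omega))).trans (hb j)

theorem mem_filt_zero (b : A⟦X⟧) : b ∈ filt A c N 0 := fun j => by
  rw [Nat.zero_sub, zero_ceilDiv, pow_zero]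
  exact one_dvd _

/-- Weights add because `x ↦ ⌈x / N⌉` is subadditive; truncated subtraction does no harm, since `(K
+ L) - (i + j) ≤ (K - i) + (L - j)`. -/
theorem mul_mem_filt {K L : ℕ} {b b' : A⟦X⟧} (hb : b ∈ filt A c N K)
    (hb' : b' ∈ filt A c N L) : b * b' ∈ filt A c N (K + L) := by
  intro j
  rw [PowerSeries.coeff_mul]
  refine Finset.dvd_sum fun ij hij => ?_
  refine (pow_dvd_pow _ ?_).trans ((pow_add (c : A) _ _).dvd.trans
    (mul_dvd_mul (hb ij.1) (hb' ij.2)))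
  have := Finset.HasAntidiagonal.mem_antidiagonal.1 hij
  rcases N.eq_zero_or_pos with rfl | hN
  · simp
  rw [ceilDiv_le_iff_le_mul hN, mul_add]
  have h1 := (ceilDiv_le_iff_le_mul hN (b := K - ij.1)).1 le_rfl
  have h2 := (ceilDiv_le_iff_le_mul hN (b := L - ij.2)).1 le_rfl
  omega

theorem pow_mem_filt {K : ℕ} {b : A⟦X⟧} (hb : b ∈ filt A c N K) (n : ℕ) :
    b ^ n ∈ filt A c N (K * n) := by
  induction n with
  | zero => exact mem_filt_zero _
  | succ n ih => rw [pow_succ, mul_add, mul_one]; exact mul_mem_filt ih hb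

theorem natCast_mem_filt : (c : A⟦X⟧) ∈ filt A c N N := by
  intro j
  rw [← map_natCast (PowerSeries.C (R := A)), PowerSeries.coeff_C]
  split_ifs with h
  · rcases N.eq_zero_or_pos with rfl | hN
    · simp
    · have h1 : N ⌈/⌉ N ≤ 1 := (ceilDiv_le_iff_le_mul hN).2 (by simp)
      rw [h, Nat.sub_zero]
      exact (pow_dvd_pow _ h1).trans (pow_one _).dvd
  · exact dvd_zero _

theorem mem_filt_one {b : A⟦X⟧} (hb : PowerSeries.constantCoeff b = 0) : b ∈ filt A c N 1 := by
  intro j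
  rcases j with _ | j
  · rw [PowerSeries.coeff_zero_eq_constantCoeff_apply, hb]
    exact dvd_zero _
  · rw [show 1 - (j + 1) = 0 by omega, zero_ceilDiv, pow_zero]
    exact one_dvd _

end Filtration

/-! ### Growth of the coefficients in `X` -/

section Column

variable {A : Type*} [CommRing A]

/-- The coefficient of `X ^ u` of an element of `A[X]⟦T⟧`, as a power series in `T`. -/
noncomputable def column (u : ℕ) (h : (Polynomial A)⟦X⟧) : A⟦X⟧ :=
  PowerSeries.mk fun j => (PowerSeries.coeff j h).coeff u

@[simp]
theorem coeff_column (u j : ℕ) (h : (Polynomial A)⟦X⟧) :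
    PowerSeries.coeff j (column u h) = (PowerSeries.coeff j h).coeff u := PowerSeries.coeff_mk _ _

theorem column_mul (u : ℕ) (g h : (Polynomial A)⟦X⟧) :
    column u (g * h) = ∑ vw ∈ Finset.HasAntidiagonal.antidiagonal u,
      column vw.1 g * column vw.2 h := by
  ext j
  simp only [coeff_column, PowerSeries.coeff_mul, map_sum, Polynomial.finsetSum_coeff,
    Polynomial.coeff_mul]
  exact Finset.sum_comm

/-- The elements of `A[X]⟦T⟧` whose coefficient of `X ^ u` lies in step `⌈u / δ⌉` of the
filtration. -/
def weightMonoid (A : Type*) [CommRing A] (c N : ℕ) (δ : ℝ) :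
    Submonoid (Polynomial A)⟦X⟧ where
  carrier := {h | ∀ u : ℕ, column u h ∈ filt A c N ⌈(u : ℝ) / δ⌉₊}
  one_mem' u := by
    rcases u with _ | u
    · simpa using mem_filt_zero _
    · convert Ideal.zero_mem _
      ext j
      rw [coeff_column, PowerSeries.coeff_one]
      split_ifs <;> simp [Polynomial.coeff_one]
  mul_mem' {g h} hg hh u := by
    rw [column_mul]
    refine Ideal.sum_mem _ fun vw hvw => filt_anti ?_ (mul_mem_filt (hg vw.1) (hh vw.2))
    rw [← Finset.HasAntidiagonal.mem_antidiagonal.1 hvw]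
    push_cast
    rw [add_div]
    exact Nat.ceil_add_le _ _

variable {c N : ℕ}

/-- The substitution `X ↦ α X ^ d` moves the coefficient of `X ^ u`, of weight at least `e u`, to
the exponent `d u`, and `d u / δ ≤ e u`. -/
theorem map_eval₂_mem_weightMonoid {B : Type*} [CommRing B] (θ : B →+* A) {δ : ℝ} (hδ : 0 < δ)
    {e d : ℕ} (hd : (d : ℝ) ≤ δ * e) (α : A) {h : (Polynomial B)⟦X⟧}
    (hh : ∀ u, column u h ∈ filt B c N (e * u)) :
    PowerSeries.map (Polynomial.eval₂RingHom (Polynomial.C.comp θ)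
      (Polynomial.C α * Polynomial.X ^ d)) h ∈ weightMonoid A c N δ := by
  intro w j
  rw [coeff_column, PowerSeries.coeff_map, Polynomial.coe_eval₂RingHom, Polynomial.eval₂_eq_sum,
    Polynomial.sum, Polynomial.finsetSum_coeff]
  refine Finset.dvd_sum fun u _ => ?_
  rw [mul_pow, ← pow_mul, ← Polynomial.C_pow, RingHom.comp_apply, ← mul_assoc, ← Polynomial.C_mul,
    Polynomial.coeff_C_mul_X_pow]
  split_ifs with hw
  · refine Dvd.dvd.mul_right ?_ _
    have h1 := map_dvd θ (hh u j)
    rw [map_pow, map_natCast, coeff_column] at h1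
    refine (pow_dvd_pow _ (ceilDiv_le_ceilDiv_of_le N (Nat.sub_le_sub_right ?_ _))).trans h1
    rw [Nat.ceil_le, div_le_iff₀ hδ, hw]
    push_cast
    nlinarith [(Nat.cast_nonneg u : (0 : ℝ) ≤ u)]
  · exact dvd_zero _

/-- By the degree bound on `G`, the monomial `X ^ u` occurs only next to powers `t ^ n` with `n ≥
u`. -/
theorem column_subst_mem_filt {G : (Polynomial A)⟦X⟧}
    (hG : ∀ n, (PowerSeries.coeff n G).natDegree ≤ n) {t : A⟦X⟧}
    (ht : PowerSeries.constantCoeff t = 0) {e : ℕ} (hte : t ∈ filt A c N e) (u : ℕ) :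
    column u (G.subst (PowerSeries.map Polynomial.C t)) ∈ filt A c N (e * u) := by
  have hs : PowerSeries.HasSubst (PowerSeries.map Polynomial.C t) := by
    refine PowerSeries.HasSubst.of_constantCoeff_zero' ?_
    rw [← PowerSeries.coeff_zero_eq_constantCoeff_apply, PowerSeries.coeff_map,
      PowerSeries.coeff_zero_eq_constantCoeff_apply, ht, map_zero]
  intro j
  rw [coeff_column, PowerSeries.coeff_subst' hs]
  rw [finsum_eq_sum _ (PowerSeries.coeff_subst_finite' hs G j), Polynomial.finsetSum_coeff]
  refine Finset.dvd_sum fun n _ => ?_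
  rw [← map_pow, PowerSeries.coeff_map, smul_eq_mul, Polynomial.coeff_mul_C]
  rcases lt_or_ge n u with h | h
  · rw [Polynomial.coeff_eq_zero_of_natDegree_lt ((hG n).trans_lt h), zero_mul]
    exact dvd_zero _
  · exact Dvd.dvd.mul_left (filt_anti (Nat.mul_le_mul_left e h) (pow_mem_filt hte n) j) _

end Column

/-! ### The parameters `1 - (1 + T) ^ (-p ^ i)` -/

section Parameter

variable (p : ℕ)

/-- The series `(1 + T)⁻¹`. -/
noncomputable def invOneAdd (R : Type*) [CommRing R] : R⟦X⟧ := PowerSeries.mk fun n => (-1) ^ n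

/-- The series `1 - (1 + T) ^ (- p ^ i)`. -/
noncomputable def param (R : Type*) [CommRing R] (i : ℕ) : R⟦X⟧ := 1 - invOneAdd R ^ p ^ i

variable {R : Type*} [CommRing R]

theorem one_add_X_mul_invOneAdd : (1 + PowerSeries.X) * invOneAdd R = 1 := by
  ext n
  rw [add_mul, one_mul, map_add]
  rcases n with _ | n
  · simp [invOneAdd]
  · rw [PowerSeries.coeff_succ_X_mul, PowerSeries.coeff_one]
    simp [invOneAdd, pow_succ]

theorem constantCoeff_invOneAdd : PowerSeries.constantCoeff (invOneAdd R) = 1 := by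
  rw [← PowerSeries.coeff_zero_eq_constantCoeff_apply]
  simp [invOneAdd]

theorem derivative_invOneAdd : d⁄dX R (invOneAdd R) = - invOneAdd R ^ 2 := by
  have h := congrArg (d⁄dX R) (one_add_X_mul_invOneAdd (R := R))
  rw [Derivation.leibniz, map_add, PowerSeries.derivative_X, PowerSeries.derivative_one] at h
  simp only [smul_eq_mul, zero_add, mul_one] at h
  linear_combination invOneAdd R * h - d⁄dX R (invOneAdd R) * one_add_X_mul_invOneAdd (R := R)

theorem constantCoeff_param (i : ℕ) : PowerSeries.constantCoeff (param p R i) = 0 := by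
  simp [param, constantCoeff_invOneAdd]

theorem hasSubst_param (i : ℕ) : PowerSeries.HasSubst (param p R i) :=
  PowerSeries.HasSubst.of_constantCoeff_zero' (constantCoeff_param p i)

theorem map_param {S : Type*} [CommRing S] (φ : R →+* S) (i : ℕ) :
    PowerSeries.map φ (param p R i) = param p S i := by
  have : PowerSeries.map φ (invOneAdd R) = invOneAdd S := by
    ext n
    simp [invOneAdd]
  rw [param, param, map_sub, map_one, map_pow, this]

theorem derivative_param [hp : Fact p.Prime] (i : ℕ) :
    d⁄dX R (param p R i) = (p : R⟦X⟧) ^ i * (invOneAdd R * (1 - param p R i)) := by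
  have h0 : p ^ i ≠ 0 := pow_ne_zero _ hp.out.ne_zero
  rw [param, map_sub, PowerSeries.derivative_one, PowerSeries.derivative_pow, derivative_invOneAdd]
  push_cast
  linear_combination (p : R⟦X⟧) ^ i * invOneAdd R * pow_sub_one_mul h0 (invOneAdd R)

/-- Consecutive parameters are related by `t ↦ 1 - (1 - t) ^ p`, which turns weight `w` into at
least `min (N + w) (p w)` with `N = p ^ m (p - 1)`. For `w = p ^ i` the minimum is `p w` exactly
when `i ≤ m`. So the weight is multiplied by `p` up to level `m + 1`; beyond that it is merely kept.
-/
theorem param_mem_filt [hp : Fact p.Prime] (m : ℕ) (i : ℕ) :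
    param p R i ∈ filt R p (p ^ m * (p - 1)) (p ^ min i (m + 1)) := by
  induction i with
  | zero => simpa using mem_filt_one (constantCoeff_param p 0)
  | succ i ih =>
    obtain ⟨r, hr⟩ : ∃ r, param p R (i + 1) =
        p * (param p R i * r) - (-param p R i) ^ p := by
      obtain ⟨r, hr⟩ := exists_add_pow_prime_eq hp.out (1 : R⟦X⟧) (-param p R i)
      refine ⟨r, ?_⟩
      have h2 : param p R (i + 1) = 1 - (1 + -param p R i) ^ p := by
        rw [param, param, pow_succ, pow_mul]
        ring
      rw [h2, hr]
      ring
    rw [hr]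
    have hp1 := hp.out.one_lt
    refine sub_mem ?_ ?_
    · rcases le_or_gt i m with him | him
      · refine filt_anti ?_ (mul_mem_filt (natCast_mem_filt) (Ideal.mul_mem_right r _ ih))
        rw [min_eq_left (by omega), min_eq_left (by omega), pow_succ]
        have h3 : p ^ i ≤ p ^ m := Nat.pow_le_pow_right hp.out.pos him
        calc p ^ i * p = p ^ i * (p - 1) + p ^ i := by
              rw [← Nat.mul_succ, Nat.succ_eq_add_one, Nat.sub_add_cancel hp1.le]
          _ ≤ _ := by gcongr
      · rw [min_eq_right (by omega)] at ih ⊢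
        exact Ideal.mul_mem_left _ _ (Ideal.mul_mem_right r _ ih)
    · refine filt_anti ?_ (pow_mem_filt (neg_mem ih) p)
      rw [← pow_succ]
      exact Nat.pow_le_pow_right hp.out.pos (by omega)

/-- Raising to the `p`-th power permutes `y, y ^ p, …, y ^ p ^ (r - 1)` cyclically. This removes the
exponents `p ^ v(m)` of the splitting function once conjugates are combined. -/
theorem sum_pow_pow_add {r : ℕ} {y : R} (hy : y ^ p ^ r = y) (v : ℕ) :
    ∑ j ∈ Finset.range r, (y ^ p ^ j) ^ p ^ v = ∑ j ∈ Finset.range r, y ^ p ^ j := by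
  induction v with
  | zero => simp
  | succ v ih =>
    rw [← ih]
    have h1 := Finset.sum_range_succ' (fun j => (y ^ p ^ j) ^ p ^ v) r
    have h2 := Finset.sum_range_succ (fun j => (y ^ p ^ j) ^ p ^ v) r
    simp only [hy, pow_zero, pow_one] at h1 h2
    have h3 := add_right_cancel (h1.symm.trans h2)
    rw [← h3]
    refine Finset.sum_congr rfl fun j _ => ?_
    rw [← pow_mul, ← pow_mul]
    ring_nf

end Parameter

/-! ### Values of the splitting function -/

section Splitting

variable (p : ℕ) [hp : Fact p.Prime]

/-- The splitting function in the parameter `1 - (1 + T) ^ (- p ^ i)`, as an element of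
`ℤ_p[X]⟦T⟧`. -/
noncomputable def levelSplitting (i : ℕ) : (Polynomial ℤ_[p])⟦X⟧ :=
  (exists_splittingFunction p).choose.subst (param p (Polynomial ℤ_[p]) i)

theorem constantCoeff_subst_eq_one {R : Type*} [CommRing R] {g t : R⟦X⟧}
    (hg : PowerSeries.constantCoeff g = 1) (ht : PowerSeries.constantCoeff t = 0) :
    PowerSeries.constantCoeff (g.subst t) = 1 := by
  have h := PowerSeries.constantCoeff_subst_eq_zero ht (g - 1) (by simp [hg])
  have hs := PowerSeries.HasSubst.of_constantCoeff_zero' ht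
  rw [PowerSeries.subst_sub hs, ← PowerSeries.coe_substAlgHom hs, map_one,
    PowerSeries.coe_substAlgHom hs] at h
  exact sub_eq_zero.1 ((map_sub PowerSeries.constantCoeff _ _).symm.trans h)

variable {R : Type*} [CommRing R]

theorem derivative_subst_of_logDeriv {g l t : R⟦X⟧} (ht : PowerSeries.HasSubst t)
    (hg : d⁄dX R g = l * g) : d⁄dX R (g.subst t) = l.subst t * d⁄dX R t * g.subst t := by
  rw [PowerSeries.derivative_subst ht, hg, PowerSeries.subst_mul ht]
  ring

theorem column_levelSplitting_mem_filt {c N : ℕ} {i e : ℕ}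
    (h : param p ℤ_[p] i ∈ filt ℤ_[p] c N e) (u : ℕ) :
    column u (levelSplitting p i) ∈ filt ℤ_[p] c N (e * u) := by
  rw [levelSplitting, ← map_param p Polynomial.C]
  exact column_subst_mem_filt (exists_splittingFunction p).choose_spec.2.2
    (constantCoeff_param p i) h u

/-- The value of the splitting function of level `i` at `X = y`. -/
noncomputable def evalSplitting (θ : ℤ_[p] →+* R) (i : ℕ) (y : R) : R⟦X⟧ :=
  PowerSeries.map (Polynomial.eval₂RingHom θ y) (levelSplitting p i)

theorem map_evalSplitting {S : Type*} [CommRing S] (φ : R →+* S) (θ : ℤ_[p] →+* R) (i : ℕ)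
    (y : R) :
    PowerSeries.map φ (evalSplitting p θ i y) = evalSplitting p (φ.comp θ) i (φ y) := by
  ext n
  simp [evalSplitting, Polynomial.hom_eval₂]

theorem constantCoeff_evalSplitting (θ : ℤ_[p] →+* R) (i : ℕ) (y : R) :
    PowerSeries.constantCoeff (evalSplitting p θ i y) = 1 := by
  have h : PowerSeries.constantCoeff (levelSplitting p i) = 1 :=
    constantCoeff_subst_eq_one (exists_splittingFunction p).choose_spec.1 (constantCoeff_param p i)
  rw [← PowerSeries.coeff_zero_eq_constantCoeff_apply, evalSplitting, PowerSeries.coeff_map,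
    PowerSeries.coeff_zero_eq_constantCoeff_apply, h, map_one]

theorem derivative_evalSplitting (θ : ℤ_[p] →+* R) (i : ℕ) (y : R) :
    d⁄dX R (evalSplitting p θ i y) =
      (splittingLogDeriv p y).subst (param p R i) * d⁄dX R (param p R i) *
        evalSplitting p θ i y := by
  have h := derivative_subst_of_logDeriv (hasSubst_param p i)
    (exists_splittingFunction p).choose_spec.2.1
  have h2 : PowerSeries.map (Polynomial.eval₂RingHom θ y) ((splittingLogDeriv p
      (Polynomial.X : Polynomial ℤ_[p])).subst (param p (Polynomial ℤ_[p]) i)) =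
      (splittingLogDeriv p y).subst (param p R i) := by
    have h3 := PowerSeries.map_subst (hasSubst_param p (R := Polynomial ℤ_[p]) i)
      (h := Polynomial.eval₂RingHom θ y) (splittingLogDeriv p (Polynomial.X : Polynomial ℤ_[p]))
    have h4 : MvPowerSeries.map (Polynomial.eval₂RingHom θ y) (param p (Polynomial ℤ_[p]) i) =
      param p R i := map_param p (Polynomial.eval₂RingHom θ y) i
    rw [h4, map_splittingLogDeriv] at h3
    refine h3.trans ?_
    simp
  rw [evalSplitting, derivative_map, levelSplitting, h, map_mul, map_mul, ← derivative_map,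
    map_param, h2]

/-- The product of the splitting functions of the conjugates of `y` has the logarithmic derivative
of `(1 + T) ^ (p ^ i * Tr y)`. -/
theorem derivative_prod_evalSplitting (θ : ℤ_[p] →+* R) (i : ℕ) {r : ℕ} {y : R}
    (hy : y ^ p ^ r = y) :
    d⁄dX R (∏ j ∈ Finset.range r, evalSplitting p θ i (y ^ p ^ j)) =
      (PowerSeries.C (p ^ i * ∑ j ∈ Finset.range r, y ^ p ^ j) * invOneAdd R) *
        ∏ j ∈ Finset.range r, evalSplitting p θ i (y ^ p ^ j) := by
  rw [derivative_prod_of_logDeriv _ fun j _ => derivative_evalSplitting p θ i (y ^ p ^ j)]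
  congr 1
  have hs := hasSubst_param p (R := R) i
  have h1 : ∑ j ∈ Finset.range r, splittingLogDeriv p (y ^ p ^ j) =
      PowerSeries.C (∑ j ∈ Finset.range r, y ^ p ^ j) * PowerSeries.mk fun _ => 1 := by
    ext n
    simp only [map_sum, splittingLogDeriv, PowerSeries.coeff_mk]
    rw [← map_sum, PowerSeries.coeff_C_mul, PowerSeries.coeff_mk, mul_one]
    exact sum_pow_pow_add p hy _
  -- Summed over the conjugates, the logarithmic derivative in `t` is a multiple of `1 / (1 - t)`;
  -- the factor `1 - t` in the derivative of the parameter cancels the denominator.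
  have h2 : (PowerSeries.mk fun _ => (1 : R)).subst (param p R i) * (1 - param p R i) = 1 := by
    have h3 : (PowerSeries.mk fun _ => (1 : R)) * (1 - PowerSeries.X) = 1 :=
      PowerSeries.mk_one_mul_one_sub_eq_one R
    have h4 := congrArg (PowerSeries.substAlgHom hs) h3
    rwa [map_mul, map_sub, map_one, PowerSeries.substAlgHom_X, PowerSeries.coe_substAlgHom] at h4
  rw [← Finset.sum_mul, ← PowerSeries.coe_substAlgHom hs, ← map_sum, h1, map_mul,
    PowerSeries.coe_substAlgHom, derivative_param]
  have h5 : (PowerSeries.C (∑ j ∈ Finset.range r, y ^ p ^ j)).subst (param p R i) =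
      PowerSeries.C (∑ j ∈ Finset.range r, y ^ p ^ j) := PowerSeries.subst_C _
  rw [h5, map_mul, map_pow, map_natCast]
  linear_combination (p : R⟦X⟧) ^ i * invOneAdd R *
    PowerSeries.C (∑ j ∈ Finset.range r, y ^ p ^ j) * h2

end Splitting

/-! ### Jacobi's formula and Newton's identities -/

section Newton

variable {n : Type*} [Fintype n] [DecidableEq n]

/-- Jacobi's formula for the derivative of a determinant. -/
theorem derivation_det {R A : Type*} [CommRing R] [CommRing A] [Algebra R A]
    (D : Derivation R A A) (M : Matrix n n A) :
    D M.det = Matrix.trace (M.adjugate * M.map D) := by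
  have hprod : ∀ (s : Finset n) (f : n → A), D (∏ i ∈ s, f i) =
      ∑ i ∈ s, D (f i) * ∏ j ∈ s.erase i, f j := by
    intro s f
    induction s using Finset.induction_on with
    | empty => simp
    | insert a s ha ih =>
      rw [Finset.prod_insert ha, Derivation.leibniz, ih, Finset.sum_insert ha,
        Finset.erase_insert ha, smul_eq_mul, smul_eq_mul, Finset.mul_sum, add_comm,
        mul_comm (∏ i ∈ s, f i)]
      congr 1
      refine Finset.sum_congr rfl fun i hi => ?_
      have hai : a ≠ i := fun h => ha (h ▸ hi)
      rw [Finset.erase_insert_of_ne hai,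
        Finset.prod_insert (fun h => ha (Finset.mem_of_mem_erase h))]
      ring
  have h1 : ∀ i, (M.adjugate * M.map D) i i = (M.updateCol i fun k => D (M k i)).det := by
    intro i
    rw [← Matrix.cramer_apply, Matrix.cramer_eq_adjugate_mulVec]
    rfl
  rw [Matrix.trace]
  simp only [Matrix.diag_apply, h1, Matrix.det_apply', map_sum]
  rw [Finset.sum_comm]
  refine Finset.sum_congr rfl fun σ _ => ?_
  rw [← zsmul_eq_mul, map_zsmul, hprod, zsmul_eq_mul, Finset.mul_sum]
  refine Finset.sum_congr rfl fun i _ => ?_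
  congr 1
  rw [← Finset.mul_prod_erase _ _ (Finset.mem_univ i), Matrix.updateCol_self]
  congr 1
  exact Finset.prod_congr rfl fun j hj => by
    rw [Matrix.updateCol_ne (Finset.ne_of_mem_erase hj)]

variable {R : Type*} [CommRing R]

/-- Newton's identities: the logarithmic derivative of `det (1 - s B)` is
`- ∑ Tr (B ^ (k + 1)) s ^ k`. -/
theorem derivative_charpolyRev (B : Matrix n n R) :
    d⁄dX R (B.charpolyRev : R⟦X⟧) =
      (- PowerSeries.mk fun k => (B ^ (k + 1)).trace) * (B.charpolyRev : R⟦X⟧) := by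
  let M : Matrix n n R⟦X⟧ := 1 - (PowerSeries.X : R⟦X⟧) • B.map PowerSeries.C
  -- The Neumann series of `M⁻¹`; hence the adjugate of `M` is `det M • S`, and Jacobi's formula
  -- produces the traces of powers.
  let S : Matrix n n R⟦X⟧ := Matrix.of fun i j => PowerSeries.mk fun k => (B ^ k) i j
  have hdet : (B.charpolyRev : R⟦X⟧) = M.det := by
    rw [Matrix.charpolyRev, ← Polynomial.coeToPowerSeries.ringHom_apply, RingHom.map_det]
    congr 1
    ext1 i j
    simp [M, Matrix.one_apply, apply_ite, PowerSeries.X_mul]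
  have hdM : M.map (d⁄dX R) = - B.map PowerSeries.C := by
    ext1 i j
    simp only [M, Matrix.map_apply, Matrix.sub_apply, Matrix.smul_apply, map_sub, smul_eq_mul,
      Derivation.leibniz, PowerSeries.derivative_C, PowerSeries.derivative_X, Matrix.one_apply,
      Matrix.neg_apply]
    split_ifs <;> simp
  have hSB : ∀ i j, (S * B.map PowerSeries.C) i j = PowerSeries.mk fun k => (B ^ (k + 1)) i j := by
    intro i j
    ext k
    simp [S, Matrix.mul_apply, pow_succ]
  have hSM : S * M = 1 := by
    have h2 : S * M = S - (PowerSeries.X : R⟦X⟧) • (S * B.map PowerSeries.C) := by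
      simp [M, mul_sub]
    rw [h2]
    ext i j k
    rw [Matrix.sub_apply, Matrix.smul_apply, hSB, smul_eq_mul, map_sub, Matrix.one_apply]
    rcases k with _ | k
    · by_cases hij : i = j <;> simp [S, hij]
    · rw [PowerSeries.coeff_succ_X_mul]
      split_ifs <;> simp [S, PowerSeries.coeff_one]
  have hadj : M.adjugate = M.det • S := by
    calc M.adjugate = S * M * M.adjugate := by rw [hSM, one_mul]
      _ = M.det • S := by rw [mul_assoc, Matrix.mul_adjugate]; simp
  rw [hdet, derivation_det, hdM, hadj, Matrix.mul_neg, Matrix.trace_neg, Matrix.smul_mul,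
    Matrix.trace_smul, smul_eq_mul, neg_mul, mul_comm]
  congr 2
  rw [Matrix.trace]
  simp only [Matrix.diag_apply, hSB]
  ext k
  simp [Matrix.trace]

end Newton

/-! ### Hodge bound for minors of a product of matrices -/

section Minors

/-- The product `A_{k-1} ⋯ A_1 A_0`. -/
def matProd {ι S : Type*} [Fintype ι] [DecidableEq ι] [CommRing S] (A : ℕ → Matrix ι ι S) :
    ℕ → Matrix ι ι S
  | 0 => 1
  | k + 1 => A k * matProd A k

/-- Multilinearity in the rows suffices here: unlike in the Cauchy–Binet formula the sum runs over
all maps `g`, and the non-injective ones contribute zero. -/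
theorem det_mul_eq_sum {m ι S : Type*} [Fintype m] [DecidableEq m] [Fintype ι] [DecidableEq ι]
    [CommRing S] (M : Matrix m ι S) (N : Matrix ι m S) :
    (M * N).det = ∑ g : m → ι, (∏ i, M i (g i)) * (N.submatrix g id).det := by
  have h : M * N = Matrix.of fun i => ∑ k, M i k • N k := by
    ext i j
    simp [Matrix.mul_apply, Finset.sum_apply]
  rw [h]
  have h2 := Matrix.detRowAlternating.toMultilinearMap.map_sum (R := S) (fun i k => M i k • N k)
  refine h2.trans (Finset.sum_congr rfl fun g _ => ?_)
  exact Matrix.detRowAlternating.toMultilinearMap.map_smul_univ (fun i => M i (g i))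
    (fun i => N (g i))

theorem le_sum_of_injective {m : Type*} [Fintype m] {g : m → ℕ} (hg : Function.Injective g) :
    (Fintype.card m : ℝ) * (Fintype.card m - 1) / 2 ≤ ∑ i, (g i : ℝ) := by
  classical
  have hinj : Function.Injective fun i => (g i : ℤ) := fun i j h => hg (Nat.cast_injective h)
  have h := Finset.sum_range_le_sum (s := Finset.univ.image fun i => (g i : ℤ)) (c := 0) (by simp)
  rw [Finset.card_image_of_injective _ hinj, Finset.sum_image fun i _ j _ h => hinj h,
    Finset.card_univ] at h
  have h2 : (∑ n ∈ Finset.range (Fintype.card m), (n : ℝ)) ≤ ∑ i, (g i : ℝ) := by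
    have : ((∑ n ∈ Finset.range (Fintype.card m), ((0 : ℤ) + n) : ℤ) : ℝ) ≤
        ((∑ i, (g i : ℤ) : ℤ) : ℝ) := by exact_mod_cast h
    simpa using this
  have h3 : ∀ n : ℕ, ∑ i ∈ Finset.range n, (i : ℝ) = n * (n - 1) / 2 := by
    intro n
    induction n with
    | zero => simp
    | succ n ih => rw [Finset.sum_range_succ, ih]; push_cast; ring
  rwa [h3] at h2

variable {R : Type*} [CommRing R] {c N : ℕ}

theorem mul_mem_filt_ceil {r s : ℝ} {b b' : R⟦X⟧} (hb : b ∈ filt R c N ⌈r⌉₊)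
    (hb' : b' ∈ filt R c N ⌈s⌉₊) : b * b' ∈ filt R c N ⌈r + s⌉₊ :=
  filt_anti (Nat.ceil_add_le r s) (mul_mem_filt hb hb')

theorem prod_mem_filt_ceil {m : Type*} (s : Finset m) {r : m → ℝ} {b : m → R⟦X⟧}
    (hb : ∀ i ∈ s, b i ∈ filt R c N ⌈r i⌉₊) :
    ∏ i ∈ s, b i ∈ filt R c N ⌈∑ i ∈ s, r i⌉₊ := by
  classical
  induction s using Finset.induction_on with
  | empty => simpa using mem_filt_zero _
  | insert a s ha ih =>
    rw [Finset.prod_insert ha, Finset.sum_insert ha]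
    exact mul_mem_filt_ceil (hb a (Finset.mem_insert_self _ _))
      (ih fun i hi => hb i (Finset.mem_insert_of_mem hi))

/-- For an intermediate family `g` of indices, the weights `p ∑ w(h) - ∑ w(g)` and `p ∑ w(g) - ∑
w(h')` add up with a surplus `(p - 1) ∑ w(g)`. If `g` is injective the surplus is at least `(p - 1)`
times `0 + 1 + ⋯ + (n - 1)`, where `n` is the size of the minor; otherwise the minor has two equal
rows. -/
theorem det_submatrix_matProd_mem_filt {ι m : Type*} [Fintype ι] [DecidableEq ι] [Fintype m]
    [DecidableEq m] {w : ι → ℕ} (hw : Function.Injective w) {p : ℕ} (hp : 1 ≤ p) {δ : ℝ}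
    (hδ : 0 < δ) {A : ℕ → Matrix ι ι R⟦X⟧}
    (hA : ∀ j u v, A j u v ∈ filt R c N ⌈((p : ℝ) * w u - w v) / δ⌉₊) (k : ℕ) (h h' : m → ι) :
    ((matProd A (k + 1)).submatrix h h').det ∈ filt R c N
      ⌈((p : ℝ) * ∑ i, (w (h i) : ℝ) - ∑ i, (w (h' i) : ℝ) +
        k * ((p - 1) * ((Fintype.card m : ℝ) * (Fintype.card m - 1) / 2))) / δ⌉₊ := by
  induction k generalizing h with
  | zero =>
    rw [matProd, matProd, mul_one, Matrix.det_apply']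
    refine Ideal.sum_mem _ fun σ _ => Ideal.mul_mem_left _ _ ?_
    refine filt_anti (Nat.ceil_mono (le_of_eq ?_))
      (prod_mem_filt_ceil Finset.univ fun i _ => hA 0 (h (σ i)) (h' i))
    rw [← Finset.sum_div, Finset.sum_sub_distrib, ← Finset.mul_sum,
      Equiv.sum_comp σ fun i => (w (h i) : ℝ)]
    simp
  | succ k ih =>
    rw [matProd, ← Matrix.submatrix_mul_equiv (A (k + 1)) _ h (Equiv.refl ι) h', det_mul_eq_sum]
    refine Ideal.sum_mem _ fun g _ => ?_
    by_cases hg : Function.Injective g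
    · refine filt_anti (Nat.ceil_mono ?_) (mul_mem_filt_ceil
        (prod_mem_filt_ceil Finset.univ fun i _ => hA (k + 1) (h i) (g i)) (ih g))
      rw [← Finset.sum_div, Finset.sum_sub_distrib, ← Finset.mul_sum, ← add_div]
      refine div_le_div_of_nonneg_right ?_ hδ.le
      have h1 := le_sum_of_injective (hw.comp hg)
      have h2 : (0 : ℝ) ≤ p - 1 := by
        have : (1 : ℝ) ≤ p := by exact_mod_cast hp
        linarith
      have h3 := mul_le_mul_of_nonneg_left h1 h2
      simp only [Function.comp_apply] at h3
      push_cast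
      linarith
    · obtain ⟨i, j, hij, hne⟩ : ∃ i j, g i = g j ∧ i ≠ j := by
        simpa [Function.Injective] using hg
      have h0 : (((matProd A (k + 1)).submatrix (Equiv.refl ι) h').submatrix g id).det = 0 :=
        Matrix.det_zero_of_row_eq hne (by ext l; simp [hij])
      rw [h0, mul_zero]
      exact Ideal.zero_mem _

/-- The Newton polygon of `det (1 - s A_k ⋯ A_0)` for matrices whose entries satisfy a Hodge type
bound. -/
theorem coeff_charpolyRev_matProd_mem_filt {ι : Type*} [Fintype ι] [DecidableEq ι]
    {w : ι → ℕ} (hw : Function.Injective w) {p : ℕ} (hp : 1 ≤ p) {δ : ℝ}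
    (hδ : 0 < δ) {A : ℕ → Matrix ι ι R⟦X⟧}
    (hA : ∀ j u v, A j u v ∈ filt R c N ⌈((p : ℝ) * w u - w v) / δ⌉₊) {a : ℕ} (ha : 0 < a)
    (n : ℕ) :
    (matProd A a).charpolyRev.coeff n ∈ filt R c N
      ⌈((a : ℝ) * ((p : ℝ) - 1) * (n : ℝ) * ((n : ℝ) - 1)) / (2 * δ)⌉₊ := by
  obtain ⟨k, rfl⟩ : ∃ k, a = k + 1 := ⟨a - 1, by omega⟩
  have hrev : (matProd A (k + 1)).charpolyRev =
      (1 + (Polynomial.X : Polynomial R⟦X⟧) • (-matProd A (k + 1)).map Polynomial.C).det := by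
    rw [Matrix.charpolyRev, sub_eq_add_neg]
    congr 2
    rw [Matrix.map_neg _ (map_neg Polynomial.C), smul_neg]
  rw [hrev, Matrix.coeff_det_one_add_X_smul_eq_sum_minors]
  refine Ideal.sum_mem _ fun s hs => ?_
  rw [Matrix.submatrix_neg, Pi.neg_apply, Pi.neg_apply, Matrix.det_neg]
  refine Ideal.mul_mem_left _ _ (filt_anti (Nat.ceil_mono ?_)
    (det_submatrix_matProd_mem_filt hw hp hδ hA k (Subtype.val : s → ι) Subtype.val))
  -- In a principal minor the boundary terms leave `(p - 1) ∑ w`, which supplies the last of the `a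
  -- = k + 1` summands.
  have h1 := le_sum_of_injective (hw.comp (Subtype.val_injective (p := (· ∈ s))))
  have hcard : Fintype.card s = n := by
    rw [Fintype.card_coe]
    exact (Finset.mem_powersetCard.1 hs).2
  rw [hcard] at h1 ⊢
  have h2 : (0 : ℝ) ≤ p - 1 := by
    have : (1 : ℝ) ≤ p := by exact_mod_cast hp
    linarith
  have h3 := mul_le_mul_of_nonneg_left h1 h2
  simp only [Function.comp_apply] at h3
  rw [← div_div]
  refine div_le_div_of_nonneg_right ?_ hδ.le
  push_cast
  linarith

end Minors

/-! ### Dwork operators on polynomials of bounded degree -/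

section DworkMatrix

variable {S : Type*} [CommRing S]

/-- The matrix of `g ↦ ψ_q (P g)` on polynomials of degree at most `L`, where `ψ_q` is the left
inverse of `X ↦ X ^ q` that drops the other monomials. -/
def dworkMatrix (q L : ℕ) (P : Polynomial S) : Matrix (Fin (L + 1)) (Fin (L + 1)) S :=
  Matrix.of fun u v => if (v : ℕ) ≤ q * u then P.coeff (q * u - v) else 0

/-- The product `∏_{j < k} P_j(X ^ (p ^ j))`. -/
noncomputable def twistedProd (p : ℕ) (P : ℕ → Polynomial S) (k : ℕ) : Polynomial S :=
  ∏ j ∈ Finset.range k, Polynomial.expand S (p ^ j) (P j)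

/-- Under this bound polynomials of degree at most `L` are stable under multiplication by the
product followed by `ψ_{p ^ k}`, so the finite matrices compose correctly. -/
theorem natDegree_twistedProd_le {p L : ℕ} (hp : 1 ≤ p) {P : ℕ → Polynomial S}
    (hP : ∀ j, (P j).natDegree ≤ (p - 1) * L) (k : ℕ) :
    (twistedProd p P k).natDegree ≤ (p ^ k - 1) * L := by
  induction k with
  | zero => simp [twistedProd]
  | succ k ih =>
    rw [twistedProd, Finset.prod_range_succ]
    refine Polynomial.natDegree_mul_le.trans ?_
    rw [Polynomial.natDegree_expand]
    calc _ ≤ (p ^ k - 1) * L + (p - 1) * L * p ^ k := by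
          gcongr
          · exact ih
          · exact hP k
      _ = ((p ^ k - 1) + (p - 1) * p ^ k) * L := by ring
      _ = (p ^ (k + 1) - 1) * L := by
        congr 1
        have h1 : 1 ≤ p ^ k := Nat.one_le_pow _ _ hp
        have h2 : 1 ≤ p ^ (k + 1) := Nat.one_le_pow _ _ hp
        zify [h1, h2, hp]
        ring

theorem coeff_mul_expand {q : ℕ} (H P : Polynomial S) (n T : ℕ)
    (hT : n < q * (T + 1)) :
    (H * Polynomial.expand S q P).coeff n = ∑ m ∈ Finset.range (T + 1),
      P.coeff m * if q * m ≤ n then H.coeff (n - q * m) else 0 := by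
  have h1 : Polynomial.expand S q P = ∑ m ∈ Finset.range (max T P.natDegree + 1),
      Polynomial.C (P.coeff m) * Polynomial.X ^ (q * m) := by
    conv_lhs => rw [P.as_sum_range' (max T P.natDegree + 1) (by omega)]
    rw [map_sum]
    refine Finset.sum_congr rfl fun m _ => ?_
    rw [Polynomial.expand_monomial, Polynomial.C_mul_X_pow_eq_monomial, mul_comm]
  rw [h1, Finset.mul_sum, Polynomial.finsetSum_coeff]
  symm
  refine (Finset.sum_subset (Finset.range_mono (by omega)) fun m _ hm => ?_).trans
    (Finset.sum_congr rfl fun m _ => ?_)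
  · rw [if_neg, mul_zero]
    rw [Finset.mem_range, not_lt] at hm
    have := Nat.mul_le_mul_left q hm
    omega
  · rw [← mul_assoc, Polynomial.coeff_mul_X_pow', mul_comm H, Polynomial.coeff_C_mul]
    split_ifs <;> simp

/-- The product of the matrices of `ψ_p ∘ P_j` is the matrix of `ψ_{p ^ k} ∘ ∏ P_j(X ^ (p ^ j))`. -/
theorem matProd_dworkMatrix {p L : ℕ} (hp : 1 ≤ p) {P : ℕ → Polynomial S}
    (hP : ∀ j, (P j).natDegree ≤ (p - 1) * L) (k : ℕ) :
    matProd (fun j => dworkMatrix p L (P j)) k = dworkMatrix (p ^ k) L (twistedProd p P k) := by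
  induction k with
  | zero =>
    ext u v
    simp only [matProd, dworkMatrix, twistedProd, Finset.range_zero, Finset.prod_empty,
      Matrix.of_apply, pow_zero, one_mul, Polynomial.coeff_one, Matrix.one_apply, Fin.ext_iff]
    split_ifs <;> first | rfl | omega
  | succ k ih =>
    ext u v
    have hpk : 0 < p ^ k := Nat.pow_pos hp
    -- The summand of the matrix product, for arbitrary `w`. It vanishes for `w > L` by degree and
    -- for `w > p * u` by definition, so the sum may run up to `p * u` and be reindexed by `m = p *
    -- u - w`.
    let f : ℕ → S := fun w => (if w ≤ p * u then (P k).coeff (p * u - w) else 0) *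
      (if (v : ℕ) ≤ p ^ k * w then (twistedProd p P k).coeff (p ^ k * w - v) else 0)
    have hf : ∀ w, L < w → f w = 0 := by
      intro w hw
      have h1 : p ^ k * (L + 1) ≤ p ^ k * w := Nat.mul_le_mul_left _ hw
      have h2 : (p ^ k - 1) * L + L = p ^ k * L := by
        rw [← Nat.succ_mul, Nat.succ_eq_add_one, Nat.sub_add_cancel hpk]
      have h3 := v.2
      simp only [f]
      rw [Polynomial.coeff_eq_zero_of_natDegree_lt (p := twistedProd p P k)]
      · simp
      · refine (natDegree_twistedProd_le hp hP k).trans_lt ?_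
        rw [mul_add] at h1
        omega
    have hf' : ∀ w, p * u < w → f w = 0 := by
      intro w hw
      simp only [f]
      rw [if_neg (by omega), zero_mul]
    have hsum : (matProd (fun j => dworkMatrix p L (P j)) (k + 1)) u v =
        ∑ w ∈ Finset.range (p * u + 1), f w := by
      rw [matProd, ih, Matrix.mul_apply]
      have e1 : ∑ w ∈ Finset.range (L + 1), f w = ∑ w ∈ Finset.range (p * u + 1), f w := by
        rcases le_total (L + 1) (p * u + 1) with h | h
        · exact Finset.sum_subset (Finset.range_mono h) fun w _ hw =>
            hf w (by simpa using hw)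
        · exact (Finset.sum_subset (Finset.range_mono h) fun w _ hw =>
            hf' w (by simpa using hw)).symm
      rw [← e1, ← Fin.sum_univ_eq_sum_range]
      rfl
    rw [hsum, ← Finset.sum_range_reflect]
    simp only [dworkMatrix, Matrix.of_apply]
    have hpk1 : p ^ (k + 1) * u = p ^ k * (p * u) := by rw [pow_succ, mul_assoc]
    split_ifs with hv
    · have h4 : twistedProd p P (k + 1) = twistedProd p P k * Polynomial.expand S (p ^ k) (P k) :=
        Finset.prod_range_succ _ _
      rw [h4, coeff_mul_expand _ _ _ (p * u) (by rw [hpk1, mul_add]; omega)]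
      refine Finset.sum_congr rfl fun m hm => ?_
      have hm' : m ≤ p * u := by simpa [Nat.lt_succ_iff] using hm
      have h5 : p ^ k * m ≤ p ^ k * (p * u) := Nat.mul_le_mul_left _ hm'
      have h6 : p * u + 1 - 1 - m = p * u - m := by omega
      simp only [f]
      rw [h6, if_pos (by omega), Nat.sub_sub_self hm', Nat.mul_sub, hpk1]
      rw [hpk1] at hv
      congr 1
      by_cases h7 : (v : ℕ) ≤ p ^ k * (p * u) - p ^ k * m
      · rw [if_pos h7, if_pos (by omega)]
        congr 1
        omega
      · rw [if_neg h7, if_neg (by omega)]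
    · refine Finset.sum_eq_zero fun m _ => ?_
      simp only [f]
      have h8 : p ^ k * (p * u + 1 - 1 - m) ≤ p ^ k * (p * u) :=
        Nat.mul_le_mul_left _ (by omega)
      rw [if_neg (c := (v : ℕ) ≤ _) (by omega), mul_zero]

/-- The trace formula for a single operator `ψ_q ∘ H`. -/
theorem sum_eval_nthRootsFinset {D : Type*} [CommRing D] [IsDomain D] {n : ℕ} (hn : 0 < n)
    {ζ : D} (hζ : IsPrimitiveRoot ζ n) (φ : D →+* S) {L : ℕ} {H : Polynomial S}
    (hH : H.natDegree ≤ n * L) :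
    ∑ x ∈ Polynomial.nthRootsFinset n (1 : D), H.eval (φ x) =
      n * (dworkMatrix (n + 1) L H).trace := by
  have hpow : ∀ m, ∑ x ∈ Polynomial.nthRootsFinset n (1 : D), x ^ m =
      if n ∣ m then (n : D) else 0 := by
    intro m
    split_ifs with h
    · obtain ⟨d, rfl⟩ := h
      rw [Finset.sum_congr rfl (g := fun _ => (1 : D))]
      · simp [hζ.card_nthRootsFinset]
      · intro x hx
        rw [pow_mul, (Polynomial.mem_nthRootsFinset hn 1).1 hx, one_pow]
    -- The permutation `x ↦ ζ x` of the roots of unity multiplies the sum by `ζ ^ m ≠ 1`, so the sum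
    -- is zero.
    · have hne : ζ ^ m - 1 ≠ 0 := by
        rw [sub_ne_zero]
        exact fun h1 => h ((hζ.pow_eq_one_iff_dvd m).1 h1)
      refine (mul_eq_zero.1 ?_).resolve_left hne
      rw [sub_mul, one_mul, sub_eq_zero, Finset.mul_sum]
      have hmem : ∀ (z : D), z ^ n = 1 → ∀ x ∈ Polynomial.nthRootsFinset n (1 : D),
          z * x ∈ Polynomial.nthRootsFinset n (1 : D) := by
        intro z hz x hx
        rw [Polynomial.mem_nthRootsFinset hn] at hx ⊢
        rw [mul_pow, hz, hx, one_mul]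
      have hinv : ζ ^ (n - 1) * ζ = 1 := by rw [pow_sub_one_mul hn.ne', hζ.pow_eq_one]
      refine Finset.sum_bij' (fun x _ => ζ * x) (fun x _ => ζ ^ (n - 1) * x)
        (fun x hx => hmem _ hζ.pow_eq_one x hx) (fun x hx => hmem _ ?_ x hx)
        (fun x _ => ?_) (fun x _ => ?_) (fun x _ => ?_)
      · rw [← pow_mul, mul_comm, pow_mul, hζ.pow_eq_one, one_pow]
      · rw [← mul_assoc, hinv, one_mul]
      · rw [← mul_assoc, mul_comm ζ, hinv, one_mul]
      · rw [mul_pow]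
  have h1 : ∀ x, H.eval (φ x) = ∑ m ∈ Finset.range (n * L + 1), H.coeff m * φ (x ^ m) := by
    intro x
    rw [Polynomial.eval_eq_sum_range' (Nat.lt_succ_of_le hH)]
    simp
  simp only [h1]
  rw [Finset.sum_comm]
  simp only [← Finset.mul_sum, ← map_sum, hpow]
  -- The diagonal index is `(n + 1) u - u = n u`; with `u ≤ L` these are all the multiples of `n` up
  -- to the degree bound.
  have h2 : (dworkMatrix (n + 1) L H).trace = ∑ u ∈ Finset.range (L + 1), H.coeff (n * u) := by
    rw [Matrix.trace, ← Fin.sum_univ_eq_sum_range]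
    refine Finset.sum_congr rfl fun u _ => ?_
    rw [Matrix.diag_apply, dworkMatrix, Matrix.of_apply, if_pos (by rw [add_mul, one_mul]; omega)]
    congr 1
    rw [add_mul, one_mul, Nat.add_sub_cancel]
  rw [h2, Finset.mul_sum]
  symm
  refine (Finset.sum_congr rfl fun u _ => ?_).trans (Finset.sum_image (s := Finset.range (L + 1))
    (g := fun u => n * u) (f := fun m => H.coeff m * φ (if n ∣ m then (n : D) else 0))
    fun u _ v _ h => Nat.eq_of_mul_eq_mul_left hn h).symm |>.trans ?_
  · rw [if_pos (dvd_mul_right _ _), map_natCast, mul_comm]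
  · refine Finset.sum_subset ?_ fun m hm hm' => ?_
    · intro m hm
      obtain ⟨u, hu, rfl⟩ := Finset.mem_image.1 hm
      have := Nat.mul_le_mul_left n (Nat.lt_succ_iff.1 (Finset.mem_range.1 hu))
      exact Finset.mem_range.2 (by omega)
    · rw [if_neg, map_zero, mul_zero]
      rintro ⟨u, rfl⟩
      refine hm' (Finset.mem_image.2 ⟨u, Finset.mem_range.2 ?_, rfl⟩)
      rw [Finset.mem_range, Nat.lt_succ_iff] at hm
      exact Nat.lt_succ_of_le (Nat.le_of_mul_le_mul_left hm hn)

end DworkMatrix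

/-! ### The trace of Witt vectors as a sum of Frobenius conjugates -/

section WittTrace

variable (p : ℕ) [hp : Fact p.Prime] (K : Type*) [Field K] [CharP K p]

theorem padicIntToWitt_injective : Function.Injective (padicIntToWitt p K) :=
  (WittVector.map_injective _ (ZMod.castHom (dvd_refl p) K).injective).comp
    (WittVector.equiv p).symm.injective

instance charZero_wittVector : CharZero (WittVector p K) :=
  charZero_of_injective_ringHom (padicIntToWitt_injective p K)

variable {K}

theorem frobenius_iterate_teichmuller (j : ℕ) (x : K) :
    (WittVector.frobenius^[j]) (WittVector.teichmuller p x) = WittVector.teichmuller p x ^ p ^ j := by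
  induction j with
  | zero => simp
  | succ j ih =>
    rw [Function.iterate_succ_apply', ih, map_pow, WittVector.frobenius_eq_map_frobenius,
      WittVector.map_teichmuller, frobenius_def, map_pow, ← pow_mul, pow_succ']

theorem frobenius_padicIntToWitt (z : ℤ_[p]) :
    WittVector.frobenius (padicIntToWitt p K z) = padicIntToWitt p K z := by
  simp only [padicIntToWitt, RingHom.comp_apply]
  rw [WittVector.frobenius_eq_map_frobenius]
  ext n
  rw [WittVector.map_coeff, WittVector.map_coeff, frobenius_def, ← map_pow, ZMod.pow_card]

theorem frobenius_iterate_padicIntToWitt (j : ℕ) (z : ℤ_[p]) :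
    (WittVector.frobenius^[j]) (padicIntToWitt p K z) = padicIntToWitt p K z :=
  Function.iterate_fixed (frobenius_padicIntToWitt p z) j

/-- Tested on Teichmüller representatives the equality descends to `K`, where the first `r` powers
of Frobenius are distinct. -/
theorem frobenius_iterate_injOn [Finite K] {r : ℕ} (hr : Nat.card K = p ^ r) {i j : ℕ} (hi : i < r)
    (hj : j < r) (h : (WittVector.frobenius^[i] : WittVector p K → WittVector p K) =
      WittVector.frobenius^[j]) : i = j := by
  have h1 : ∀ x : K, x ^ p ^ i = x ^ p ^ j := by
    intro x
    have h2 := congrArg (fun z => WittVector.coeff z 0) (congrFun h (WittVector.teichmuller p x))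
    simpa only [frobenius_iterate_teichmuller, ← map_pow, WittVector.teichmuller_coeff_zero] using h2
  let := ZMod.algebra K p
  have hrank : Module.finrank (ZMod p) K = r := by
    have h3 := Module.natCard_eq_pow_finrank (K := ZMod p) (V := K)
    rw [hr, Nat.card_zmod] at h3
    exact (Nat.pow_right_injective hp.out.two_le h3).symm
  have hb := (FiniteField.bijective_frobeniusAlgEquivOfAlgebraic_pow (ZMod p) K).1
  have h4 := @hb ⟨i, hrank ▸ hi⟩ ⟨j, hrank ▸ hj⟩ (by
    ext x
    simpa [FiniteField.coe_frobeniusAlgEquivOfAlgebraic_iterate, ZMod.card, AlgEquiv.coe_pow]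
      using h1 x)
  simpa using h4

theorem eq_zero_of_forall_pow_dvd [PerfectRing K p] {z : WittVector p K}
    (h : ∀ n, (p : WittVector p K) ^ n ∣ z) : z = 0 := by
  ext n
  have h1 := h (n + 1)
  rw [← Ideal.mem_span_singleton, WittVector.mem_span_p_pow_iff_le_coeff_eq_zero] at h1
  rw [h1 n (Nat.lt_succ_self n), WittVector.zero_coeff]

/-- A basis of `W(K)` over `ℤ_p`. -/
theorem exists_wittVector_basis [Finite K] {r : ℕ} (hr : Nat.card K = p ^ r) :
    ∃ e : Fin r → WittVector p K, Function.Bijective fun c : Fin r → ℤ_[p] =>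
      ∑ i, padicIntToWitt p K (c i) * e i := by
  let := ZMod.algebra K p
  have hrank : Module.finrank (ZMod p) K = r := by
    have h3 := Module.natCard_eq_pow_finrank (K := ZMod p) (V := K)
    rw [hr, Nat.card_zmod] at h3
    exact (Nat.pow_right_injective hp.out.two_le h3).symm
  let b := Module.finBasisOfFinrankEq (ZMod p) K hrank
  let θ := padicIntToWitt p K
  let g : ℤ_[p] →+* ZMod p :=
    (WittVector.constantCoeff (R := ZMod p)).comp (WittVector.equiv p).symm.toRingHom
  have hθ : ∀ z : ℤ_[p], WittVector.constantCoeff (θ z) = algebraMap (ZMod p) K (g z) := fun _ => rfl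
  have hg : ∀ z : ℤ_[p], g z = 0 → (p : ℤ_[p]) ∣ z := by
    intro z hz
    by_contra hnd
    have hu : IsUnit z := by
      by_contra hu
      rw [← mem_nonunits_iff, ← IsLocalRing.mem_maximalIdeal, PadicInt.maximalIdeal_eq_span_p,
        Ideal.mem_span_singleton] at hu
      exact hnd hu
    exact (hu.map g).ne_zero hz
  let e : Fin r → WittVector p K := fun i => WittVector.teichmuller p (b i)
  let f : (Fin r → ℤ_[p]) →+ WittVector p K :=
    { toFun := fun c => ∑ i, θ (c i) * e i
      map_zero' := by simp
      map_add' := fun c d => by simp [add_mul, Finset.sum_add_distrib] }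
  have hf : ∀ c, f c = ∑ i, θ (c i) * e i := fun _ => rfl
  have hfC : ∀ c, WittVector.constantCoeff (f c) = ∑ i, g (c i) • b i := by
    intro c
    rw [hf, map_sum]
    refine Finset.sum_congr rfl fun i _ => ?_
    rw [map_mul, hθ, Algebra.smul_def]
    rfl
  have hfp : ∀ (n : ℕ) c, f (fun i => p ^ n * c i) = p ^ n * f c := by
    intro n c
    rw [hf, hf, Finset.mul_sum]
    refine Finset.sum_congr rfl fun i _ => ?_
    rw [map_mul, map_pow, map_natCast, mul_assoc]
  have hp0 : (p : WittVector p K) ≠ 0 := by exact_mod_cast hp.out.ne_zero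
  refine ⟨e, show Function.Bijective f from ⟨?_, ?_⟩⟩
  · rw [injective_iff_map_eq_zero]
    intro c hc
    -- A relation reduces modulo `p` to one among the basis `b`, so its coefficients are divisible
    -- by `p`; divide by `p` and repeat.
    have key : ∀ n : ℕ, ∃ d : Fin r → ℤ_[p], c = fun i => p ^ n * d i := by
      intro n
      induction n with
      | zero => exact ⟨c, by simp⟩
      | succ n ih =>
        obtain ⟨d, hd⟩ := ih
        have h1 : f d = 0 := by
          rw [hd, hfp] at hc
          exact (mul_eq_zero.1 hc).resolve_left (pow_ne_zero _ hp0)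
        have h2 := hfC d
        rw [h1, map_zero] at h2
        have h3 := Fintype.linearIndependent_iff.1 b.linearIndependent _ h2.symm
        choose d' hd' using fun i => hg _ (h3 i)
        refine ⟨d', hd.trans (funext fun i => ?_)⟩
        rw [hd', pow_succ, mul_assoc]
    ext1 i
    by_contra hci
    obtain ⟨d, hd⟩ := key ((c i).valuation + 1)
    have h4 := congrFun hd i
    have h5 : c i ∈ Ideal.span {(p : ℤ_[p]) ^ ((c i).valuation + 1)} :=
      Ideal.mem_span_singleton.2 ⟨d i, h4⟩
    rw [PadicInt.mem_span_pow_iff_le_valuation _ hci] at h5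
    omega
  · intro z
    -- Surjectivity by successive approximation: lift the coordinates of the residue and continue
    -- with the quotient of the error by `p`.
    have step : ∀ z : WittVector p K, ∃ c z', z = f c + p * z' := by
      intro z
      refine ⟨fun i => ((b.repr (WittVector.constantCoeff z) i).val : ℤ_[p]), ?_⟩
      obtain ⟨z', hz'⟩ := Ideal.mem_span_singleton.1 ((WittVector.mem_span_p_iff_coeff_zero_eq_zero
        (z - f fun i => ((b.repr (WittVector.constantCoeff z) i).val : ℤ_[p]))).2 (by
          have h1 := hfC fun i => ((b.repr (WittVector.constantCoeff z) i).val : ℤ_[p])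
          simp only [map_natCast (f := g), ZMod.natCast_zmod_val, b.sum_repr] at h1
          change WittVector.constantCoeff (z - _) = 0
          rw [map_sub, h1, sub_self]))
      exact ⟨z', by rw [← hz']; ring⟩
    choose c t ht using step
    let s : ℕ → Fin r → ℤ_[p] := fun n i => ∑ k ∈ Finset.range n, p ^ k * c (t^[k] z) i
    have hs : ∀ n, z = f (s n) + p ^ n * t^[n] z := by
      intro n
      induction n with
      | zero =>
        have : s 0 = 0 := by ext i; simp [s]
        rw [this, map_zero]
        simp
      | succ n ih =>
        have h1 : s (n + 1) = s n + fun i => p ^ n * c (t^[n] z) i := by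
          ext1 i
          simp [s, Finset.sum_range_succ]
        rw [h1, map_add, hfp, Function.iterate_succ_apply']
        conv_lhs => rw [ih, ht (t^[n] z)]
        ring
    have hlim : ∀ i, ∃ L : ℤ_[p], ∀ n, (p : ℤ_[p]) ^ n ∣ s n i - L := by
      intro i
      obtain ⟨L, hL⟩ := IsPrecomplete.prec' (I := IsLocalRing.maximalIdeal ℤ_[p])
        (M := ℤ_[p]) (fun n => s n i) (by
          intro m n hmn
          rw [SModEq.sub_mem, smul_eq_mul, Ideal.mul_top, PadicInt.maximalIdeal_eq_span_p,
            Ideal.span_singleton_pow, Ideal.mem_span_singleton, dvd_sub_comm]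
          simp only [s]
          rw [← Finset.sum_range_add_sum_Ico _ hmn, add_sub_cancel_left]
          refine Finset.dvd_sum fun k hk => Dvd.dvd.mul_right (pow_dvd_pow _ ?_) _
          exact (Finset.mem_Ico.1 hk).1)
      refine ⟨L, fun n => ?_⟩
      have := hL n
      rwa [SModEq.sub_mem, smul_eq_mul, Ideal.mul_top, PadicInt.maximalIdeal_eq_span_p,
            Ideal.span_singleton_pow, Ideal.mem_span_singleton] at this
    choose L hL using hlim
    refine ⟨L, ?_⟩
    refine (sub_eq_zero.1 (eq_zero_of_forall_pow_dvd p fun n => ?_)).symm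
    choose d hd using fun i => hL i n
    have h2 : s n = L + fun i => p ^ n * d i := by
      ext1 i
      rw [Pi.add_apply, ← hd i]
      ring
    refine ⟨f d + t^[n] z, ?_⟩
    conv_lhs => rw [hs n, h2, map_add, hfp]
    ring

/-- The trace from `W(K)` to `ℤ_p` is the sum of the Frobenius conjugates. -/
theorem padicIntToWitt_wittTrace [Finite K] {r : ℕ} (hr : Nat.card K = p ^ r)
    (z : WittVector p K) :
    padicIntToWitt p K (wittTrace p K z) = ∑ j ∈ Finset.range r, (WittVector.frobenius^[j]) z := by
  obtain ⟨e, he⟩ := exists_wittVector_basis p hr (K := K)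
  let θ := padicIntToWitt p K
  let : Algebra ℤ_[p] (WittVector p K) := θ.toAlgebra
  have hsmul : ∀ (x : ℤ_[p]) (y : WittVector p K), x • y = θ x * y := fun _ _ => rfl
  let E : (Fin r → ℤ_[p]) ≃ₗ[ℤ_[p]] WittVector p K := LinearEquiv.ofBijective
    (Fintype.linearCombination ℤ_[p] e) he
  let b : Module.Basis (Fin r) ℤ_[p] (WittVector p K) := Module.Basis.ofEquivFun E.symm
  let φ : ℕ → (WittVector p K →+* WittVector p K) := fun j => WittVector.frobenius ^ j
  have hφ : ∀ j x, φ j x = (WittVector.frobenius^[j]) x := fun j x => by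
    simp [φ, RingHom.coe_pow]
  let V : Matrix (Fin r) (Fin r) (WittVector p K) := Matrix.of fun k i => φ k (b i)
  let m : Matrix (Fin r) (Fin r) (WittVector p K) := (Algebra.leftMulMatrix b z).map θ
  have hφθ : ∀ j x, φ j (θ x) = θ x := fun j x => by
    rw [hφ]; exact frobenius_iterate_padicIntToWitt p j x
  -- `V` intertwines multiplication by `z`, written in the basis `b`, with the diagonal matrix of
  -- the conjugates of `z`. As soon as `det V ≠ 0`, the traces agree.
  have hcomm : Matrix.diagonal (fun k : Fin r => φ k z) * V = V * m := by
    ext1 k i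
    rw [Matrix.diagonal_mul, Matrix.mul_apply]
    have h1 : z * b i = ∑ l, b l * θ (Algebra.leftMulMatrix b z l i) := by
      conv_lhs => rw [← b.sum_repr (z * b i)]
      refine Finset.sum_congr rfl fun l _ => ?_
      rw [Algebra.leftMulMatrix_eq_repr_mul, hsmul, mul_comm]
    have h2 := congrArg (φ k) h1
    rw [map_mul, map_sum] at h2
    simpa [V, m, hφθ] using h2
  -- A relation between the rows of `V` would be a linear relation between the distinct characters
  -- `φ k`, contrary to Dedekind's theorem.
  have hdet : V.det ≠ 0 := by
    intro h0
    rw [← Matrix.det_transpose] at h0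
    obtain ⟨v, hv, hVv⟩ := Matrix.exists_mulVec_eq_zero_iff.2 h0
    have hzero : ∀ x, ∑ k : Fin r, v k * φ k x = 0 := by
      intro x
      have h3 : ∀ i, ∑ k : Fin r, v k * φ k (b i) = 0 := by
        intro i
        have := congrFun hVv i
        simpa [Matrix.mulVec, dotProduct, V, mul_comm] using this
      rw [← b.sum_repr x]
      simp only [map_sum, hsmul, map_mul, hφθ, Finset.mul_sum]
      rw [Finset.sum_comm]
      refine Finset.sum_eq_zero fun i _ => ?_
      have h4 := congrArg (fun y => θ (b.repr x i) * y) (h3 i)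
      simp only [mul_zero, Finset.mul_sum] at h4
      rw [← h4]
      exact Finset.sum_congr rfl fun k _ => by ring
    have hli := (linearIndependent_monoidHom (WittVector p K) (WittVector p K)).comp
      (fun k : Fin r => ((φ k : WittVector p K →+* WittVector p K) : WittVector p K →* WittVector p K))
      (by
        intro k l hkl
        refine Fin.ext (frobenius_iterate_injOn p hr k.2 l.2 (funext fun x => ?_))
        have := DFunLike.congr_fun hkl x
        simpa [hφ] using this)
    refine hv (funext fun k => Fintype.linearIndependent_iff.1 hli v (funext fun x => ?_) k)
    simpa using hzero x
  have htr : V.det * m.trace = V.det * ∑ k : Fin r, φ k z := by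
    have h5 : (V * m * V.adjugate).trace = V.det * m.trace := by
      rw [Matrix.trace_mul_cycle, Matrix.adjugate_mul, Matrix.smul_mul, one_mul,
        Matrix.trace_smul, smul_eq_mul]
    rw [← h5, ← hcomm, mul_assoc, Matrix.mul_adjugate, Matrix.mul_smul, mul_one,
      Matrix.trace_smul, Matrix.trace_diagonal, smul_eq_mul]
  have h6 := mul_left_cancel₀ hdet htr
  have h7 : padicIntToWitt p K (wittTrace p K z) = m.trace := by
    rw [wittTrace]
    change θ (Algebra.trace ℤ_[p] (WittVector p K) z) = _
    rw [Algebra.trace_eq_matrix_trace b, Matrix.trace, Matrix.trace, map_sum]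
    rfl
  rw [h7, h6, ← Fin.sum_univ_eq_sum_range]
  exact Finset.sum_congr rfl fun k _ => hφ k z

/-- A primitive root of unity of order `#K - 1` in `W(K)`. -/
theorem exists_isPrimitiveRoot_teichmuller {L : Type*} [Field L] [Finite L] :
    ∃ g : L, IsPrimitiveRoot (WittVector.teichmuller p g) (Nat.card L - 1) := by
  obtain ⟨g, hg⟩ := IsCyclic.exists_generator (α := Lˣ)
  have h1 : orderOf g = Nat.card L - 1 := by
    rw [orderOf_eq_card_of_forall_mem_zpowers hg, Nat.card_units]
  refine ⟨g, ?_⟩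
  have h2 : IsPrimitiveRoot (g : L) (Nat.card L - 1) := by
    rw [← h1, IsPrimitiveRoot.coe_units_iff]
    exact IsPrimitiveRoot.orderOf g
  refine h2.map_of_injective (f := WittVector.teichmuller p) fun x y hxy => ?_
  simpa using congrArg (fun z => WittVector.coeff z 0) hxy

theorem exists_teichmuller_eq_of_mem_nthRootsFinset [Finite K] {x : WittVector p K}
    (hx : x ∈ Polynomial.nthRootsFinset (Nat.card K - 1) (1 : WittVector p K)) :
    ∃ y : K, x = WittVector.teichmuller p y := by
  obtain ⟨g, hg⟩ := exists_isPrimitiveRoot_teichmuller p (L := K)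
  have hpos : 0 < Nat.card K - 1 := by
    have := Finite.one_lt_card (α := K)
    omega
  have : NeZero (Nat.card K - 1) := ⟨hpos.ne'⟩
  obtain ⟨i, -, hi⟩ := hg.eq_pow_of_pow_eq_one ((Polynomial.mem_nthRootsFinset hpos 1).1 hx)
  exact ⟨g ^ i, by rw [← hi, map_pow]⟩

end WittTrace

/-! ### Periodic products and base change -/

section MatProd

variable {ι S : Type*} [Fintype ι] [DecidableEq ι] [CommRing S]

theorem matProd_add (A : ℕ → Matrix ι ι S) (m n : ℕ) :
    matProd A (m + n) = matProd (fun j => A (j + n)) m * matProd A n := by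
  induction m with
  | zero => simp [matProd]
  | succ m ih => rw [Nat.succ_add, matProd, ih, matProd, mul_assoc]

theorem matProd_mul_of_periodic {A : ℕ → Matrix ι ι S} {a : ℕ} (hA : ∀ j, A (j + a) = A j)
    (k : ℕ) : matProd A (a * k) = matProd A a ^ k := by
  induction k with
  | zero => simp [matProd]
  | succ k ih =>
    have h : ∀ j, A (j + a * k) = A j := by
      clear ih
      intro j
      induction k with
      | zero => simp
      | succ k ih => rw [mul_add, mul_one, ← add_assoc, hA, ih]
    rw [mul_add, mul_one, add_comm, matProd_add, ih, pow_succ']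
    simp only [h]

theorem map_dworkMatrix {S' : Type*} [CommRing S'] (φ : S →+* S') (q L : ℕ) (P : Polynomial S) :
    (dworkMatrix q L P).map φ = dworkMatrix q L (P.map φ) := by
  ext u v
  simp only [dworkMatrix, Matrix.map_apply, Matrix.of_apply, Polynomial.coeff_map]
  split_ifs <;> simp

theorem map_twistedProd {S' : Type*} [CommRing S'] (φ : S →+* S') (p : ℕ) (P : ℕ → Polynomial S)
    (k : ℕ) : (twistedProd p P k).map φ = twistedProd p (fun j => (P j).map φ) k := by
  simp [twistedProd, Polynomial.map_prod, Polynomial.map_expand]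

end MatProd

/-! ### Truncation modulo `T ^ M` -/

section Truncation

variable {A : Type*} [CommRing A]

/-- The truncation modulo `T ^ M` of an element of `A[X]⟦T⟧`, as a polynomial in `X` of degree at
most `L`. -/
noncomputable def truncPoly (M L : ℕ) (h : (Polynomial A)⟦X⟧) : Polynomial A⟦X⟧ :=
  ∑ u ∈ Finset.range (L + 1),
    Polynomial.monomial u ((PowerSeries.trunc M (column u h) : Polynomial A) : A⟦X⟧)

theorem coeff_truncPoly (M L : ℕ) (h : (Polynomial A)⟦X⟧) (u : ℕ) :
    (truncPoly M L h).coeff u = if u ≤ L then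
      ((PowerSeries.trunc M (column u h) : Polynomial A) : A⟦X⟧) else 0 := by
  rw [truncPoly, Polynomial.finsetSum_coeff]
  simp [Polynomial.coeff_monomial]

theorem natDegree_truncPoly_le (M L : ℕ) (h : (Polynomial A)⟦X⟧) :
    (truncPoly M L h).natDegree ≤ L := by
  rw [Polynomial.natDegree_le_iff_coeff_eq_zero]
  intro u hu
  rw [coeff_truncPoly, if_neg (by omega)]

theorem coeff_truncPoly_mem_filt {c N : ℕ} {δ : ℝ} {h : (Polynomial A)⟦X⟧}
    (hh : h ∈ weightMonoid A c N δ) (M L u : ℕ) :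
    (truncPoly M L h).coeff u ∈ filt A c N ⌈(u : ℝ) / δ⌉₊ := by
  rw [coeff_truncPoly]
  split_ifs
  · intro j
    rw [Polynomial.coeff_coe, PowerSeries.coeff_trunc]
    split_ifs
    · exact hh u j
    · exact dvd_zero _
  · exact Ideal.zero_mem _

theorem dworkMatrix_truncPoly_mem_filt {c N : ℕ} {δ : ℝ} {h : (Polynomial A)⟦X⟧}
    (hh : h ∈ weightMonoid A c N δ) (M L L' p : ℕ) (u v : Fin (L' + 1)) :
    dworkMatrix p L' (truncPoly M L h) u v ∈
      filt A c N ⌈((p : ℝ) * (u : ℕ) - (v : ℕ)) / δ⌉₊ := by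
  rw [dworkMatrix, Matrix.of_apply]
  split_ifs with hv
  · have := coeff_truncPoly_mem_filt hh M L (p * u - v)
    rw [Nat.cast_sub hv, Nat.cast_mul] at this
    exact this
  · exact Ideal.zero_mem _

/-- Evaluation commutes with truncation modulo `T ^ M`. -/
theorem X_pow_dvd_eval_truncPoly_sub {B : Type*} [CommRing B] (ρ : A →+* B) (x : B) {D M : ℕ}
    {h : (Polynomial A)⟦X⟧} (hh : ∀ j, (PowerSeries.coeff j h).natDegree ≤ D * j) :
    PowerSeries.X ^ M ∣ ((truncPoly M (D * M) h).map (PowerSeries.map ρ)).eval (PowerSeries.C x) -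
      PowerSeries.map (Polynomial.eval₂RingHom ρ x) h := by
  rw [PowerSeries.X_pow_dvd_iff]
  intro j hj
  rw [map_sub, sub_eq_zero, PowerSeries.coeff_map, Polynomial.coe_eval₂RingHom,
    Polynomial.eval₂_eq_sum_range' _ (n := D * M + 1), Polynomial.eval_eq_sum_range'
      (n := D * M + 1), map_sum]
  · refine Finset.sum_congr rfl fun u hu => ?_
    rw [Polynomial.coeff_map, coeff_truncPoly, if_pos (Nat.lt_succ_iff.1 (Finset.mem_range.1 hu)),
      ← map_pow, PowerSeries.coeff_mul_C, PowerSeries.coeff_map, Polynomial.coeff_coe,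
      PowerSeries.coeff_trunc, if_pos hj, coeff_column]
  · exact Nat.lt_succ_of_le (Polynomial.natDegree_map_le.trans (natDegree_truncPoly_le _ _ _))
  -- Below `T ^ M` the degree in `X` is at most `D * M`, so the cut-off loses nothing.
  · exact Nat.lt_succ_of_le ((hh j).trans (Nat.mul_le_mul_left _ hj.le))

/-- If `u > D j`, then the weight `u / D` exceeds `j`; for `c = 0`, `N = 1` this says that the
coefficient of `T ^ j` is zero. -/
theorem natDegree_le_of_mem_weightMonoid {D : ℕ} (hD : 0 < D) {h : (Polynomial A)⟦X⟧}
    (hh : h ∈ weightMonoid A 0 1 D) (j : ℕ) : (PowerSeries.coeff j h).natDegree ≤ D * j := by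
  rw [Polynomial.natDegree_le_iff_coeff_eq_zero]
  intro u hu
  have h1 := hh u j
  have h2 : j < ⌈(u : ℝ) / D⌉₊ := by
    rw [Nat.lt_ceil, lt_div_iff₀ (by exact_mod_cast hD)]
    exact_mod_cast (mul_comm D j ▸ hu)
  rw [ceilDiv_one, Nat.cast_zero, zero_pow (by omega), zero_dvd_iff, coeff_column] at h1
  exact h1

theorem X_pow_dvd_prod_sub_prod {ι : Type*} (s : Finset ι) {M : ℕ} {g h : ι → A⟦X⟧}
    (hgh : ∀ i ∈ s, PowerSeries.X ^ M ∣ g i - h i) :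
    PowerSeries.X ^ M ∣ ∏ i ∈ s, g i - ∏ i ∈ s, h i := by
  simp only [← Ideal.mem_span_singleton, ← Ideal.Quotient.eq] at hgh ⊢
  rw [map_prod, map_prod]
  exact Finset.prod_congr rfl hgh

end Truncation

/-! ### The binomial series -/

section Binomial

theorem derivative_binomialSeries (p : ℕ) [Fact p.Prime] (z : ℤ_[p]) :
    d⁄dX ℤ_[p] (PowerSeries.binomialSeries ℤ_[p] z) =
      (PowerSeries.C z * invOneAdd ℤ_[p]) * PowerSeries.binomialSeries ℤ_[p] z := by
  have h : (1 + PowerSeries.X) * d⁄dX ℤ_[p] (PowerSeries.binomialSeries ℤ_[p] z) =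
      PowerSeries.C z * PowerSeries.binomialSeries ℤ_[p] z := by
    ext n
    have h2 : ∀ n : ℕ, ((n : ℤ_[p]) + 1) * Ring.choose z (n + 1) = (z - n) * Ring.choose z n := by
      intro n
      have := Ring.choose_smul_choose z (Nat.le_succ n)
      rw [Nat.choose_succ_self_right, Nat.succ_sub (le_refl n), Nat.sub_self,
        Ring.choose_one_right, nsmul_eq_mul] at this
      push_cast at this
      linear_combination this
    rw [add_mul, one_mul, map_add, PowerSeries.coeff_C_mul]
    rcases n with _ | n
    · have := h2 0
      simp [PowerSeries.coeff_derivative] at this ⊢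
    · rw [PowerSeries.coeff_succ_X_mul]
      have := h2 (n + 1)
      simp only [PowerSeries.coeff_derivative, PowerSeries.binomialSeries_coeff, smul_eq_mul,
        mul_one] at this ⊢
      push_cast at this ⊢
      linear_combination this
  linear_combination invOneAdd ℤ_[p] * h - d⁄dX ℤ_[p] (PowerSeries.binomialSeries ℤ_[p] z) *
    one_add_X_mul_invOneAdd (R := ℤ_[p])

end Binomial

/-! ### The Dwork trace formula -/

section TraceFormula

variable (p : ℕ) [hp : Fact p.Prime] {F : Type*} [Field F] [CharP F p] (f : ℕ → Polynomial F)

/-- The partial sum `∑_{i < l} p ^ i f̂_i`. -/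
noncomputable def partialHat (l : ℕ) : Polynomial (WittVector p F) :=
  ∑ i ∈ Finset.range l, ∑ u ∈ Finset.range ((f i).natDegree + 1),
    Polynomial.monomial u ((p : WittVector p F) ^ i * WittVector.teichmuller p ((f i).coeff u))

/-- The `j`-th conjugate of the splitting function of `∑_{i < l} p ^ i f̂_i`. -/
noncomputable def conjSplitting (l j : ℕ) : (Polynomial (WittVector p F))⟦X⟧ :=
  ∏ i ∈ Finset.range l, ∏ u ∈ Finset.range ((f i).natDegree + 1),
    evalSplitting p (Polynomial.C.comp (padicIntToWitt p F)) i
      (Polynomial.C (WittVector.teichmuller p ((f i).coeff u) ^ p ^ j) * Polynomial.X ^ u)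

theorem conjSplitting_mem_weightMonoid {c N : ℕ} {δ : ℝ} (hδ : 0 < δ) {e : ℕ → ℕ}
    (he : ∀ i, param p ℤ_[p] i ∈ filt ℤ_[p] c N (e i))
    (hd : ∀ i, ((f i).natDegree : ℝ) ≤ δ * e i) (l j : ℕ) :
    conjSplitting p f l j ∈ weightMonoid (WittVector p F) c N δ := by
  refine Submonoid.prod_mem _ fun i _ => Submonoid.prod_mem _ fun u hu => ?_
  refine map_eval₂_mem_weightMonoid _ hδ (le_trans ?_ (hd i)) _
    (column_levelSplitting_mem_filt p (he i))
  exact_mod_cast Nat.lt_succ_iff.1 (Finset.mem_range.1 hu)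

/-- The coefficients lie in a field with `p ^ a` elements, so their conjugates are `a`-periodic.
This turns a product of `a k` matrices into the `k`-th power of one matrix. -/
theorem conjSplitting_add [Finite F] {a : ℕ} (hF : Nat.card F = p ^ a) (l j : ℕ) :
    conjSplitting p f l (j + a) = conjSplitting p f l j := by
  have h : ∀ y : F, WittVector.teichmuller p y ^ p ^ (j + a) =
      WittVector.teichmuller p y ^ p ^ j := by
    intro y
    have : Fintype F := Fintype.ofFinite F
    have h1 : y ^ p ^ a = y := by
      rw [← hF, Nat.card_eq_fintype_card]
      exact FiniteField.pow_card y
    rw [pow_add, mul_comm, pow_mul, ← map_pow, h1]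
  simp only [conjSplitting, h]

variable {K : Type*} [Field K] [CharP K p] (σ : F →+* K)

theorem map_comp_padicIntToWitt :
    (WittVector.map σ).comp (padicIntToWitt p F) = padicIntToWitt p K := by
  have h : σ.comp (ZMod.castHom (dvd_refl p) F) = ZMod.castHom (dvd_refl p) K :=
    RingHom.ext_zmod _ _
  ext z n
  simp only [padicIntToWitt, RingHom.comp_apply, WittVector.map_coeff]
  exact congrArg (fun g : ZMod p →+* K => g _) h

/-- The value at a Teichmüller representative of the product of the conjugate splitting functions
is `(1 + T) ^ Tr(f̂(x))`. -/
theorem prod_map_conjSplitting [Finite K] {r : ℕ} (hK : Nat.card K = p ^ r) (l : ℕ) (y : K) :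
    ∏ j ∈ Finset.range r, PowerSeries.map (Polynomial.eval₂RingHom (WittVector.map σ)
        (WittVector.teichmuller p y ^ p ^ j)) (conjSplitting p f l j) =
      PowerSeries.map (padicIntToWitt p K) (PowerSeries.binomialSeries ℤ_[p]
        (wittTrace p K ((partialHat p f l).eval₂ (WittVector.map σ)
          (WittVector.teichmuller p y)))) := by
  let Y : ℕ → ℕ → WittVector p K := fun i u =>
    WittVector.teichmuller p (σ ((f i).coeff u) * y ^ u)
  have hY : ∀ i u, Y i u ^ p ^ r = Y i u := by
    intro i u
    have : Fintype K := Fintype.ofFinite K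
    simp only [Y]
    rw [← map_pow, ← hK, Nat.card_eq_fintype_card, FiniteField.pow_card]
  have h1 : ∏ j ∈ Finset.range r, PowerSeries.map (Polynomial.eval₂RingHom (WittVector.map σ)
        (WittVector.teichmuller p y ^ p ^ j)) (conjSplitting p f l j) =
      ∏ i ∈ Finset.range l, ∏ u ∈ Finset.range ((f i).natDegree + 1), ∏ j ∈ Finset.range r,
        evalSplitting p (padicIntToWitt p K) i (Y i u ^ p ^ j) := by
    simp only [conjSplitting, map_prod, map_evalSplitting]
    rw [Finset.prod_comm]
    refine Finset.prod_congr rfl fun i _ => ?_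
    rw [Finset.prod_comm]
    refine Finset.prod_congr rfl fun u _ => Finset.prod_congr rfl fun j _ => ?_
    congr 1
    · rw [← map_comp_padicIntToWitt p σ]
      ext z
      simp
    · simp only [Polynomial.coe_eval₂RingHom, Polynomial.eval₂_C,
        Polynomial.eval₂_X, map_pow, WittVector.map_teichmuller, Y, map_mul]
      ring
  have h2 : (partialHat p f l).eval₂ (WittVector.map σ) (WittVector.teichmuller p y) =
      ∑ i ∈ Finset.range l, ∑ u ∈ Finset.range ((f i).natDegree + 1),
        (p : WittVector p K) ^ i * Y i u := by
    simp only [partialHat, Polynomial.eval₂_finsetSum, Polynomial.eval₂_monomial, map_mul, map_pow,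
      map_natCast, WittVector.map_teichmuller, Y, mul_assoc]
  have h3 : padicIntToWitt p K (wittTrace p K ((partialHat p f l).eval₂ (WittVector.map σ)
      (WittVector.teichmuller p y))) =
      ∑ i ∈ Finset.range l, ∑ u ∈ Finset.range ((f i).natDegree + 1),
        (p : WittVector p K) ^ i * ∑ j ∈ Finset.range r, Y i u ^ p ^ j := by
    rw [padicIntToWitt_wittTrace p hK, h2]
    have h4 : ∀ j, (WittVector.frobenius^[j]) (∑ i ∈ Finset.range l,
        ∑ u ∈ Finset.range ((f i).natDegree + 1), (p : WittVector p K) ^ i * Y i u) =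
        ∑ i ∈ Finset.range l, ∑ u ∈ Finset.range ((f i).natDegree + 1),
          (p : WittVector p K) ^ i * Y i u ^ p ^ j := by
      intro j
      rw [← RingHom.coe_pow]
      simp only [map_sum, map_mul, map_pow, map_natCast]
      refine Finset.sum_congr rfl fun i _ => Finset.sum_congr rfl fun u _ => ?_
      rw [RingHom.coe_pow, frobenius_iterate_teichmuller]
    simp only [h4, Finset.mul_sum]
    rw [Finset.sum_comm]
    exact Finset.sum_congr rfl fun i _ => Finset.sum_comm
  rw [h1]
  -- Both sides have constant term `1` and logarithmic derivative `Tr / (1 + T)`, with the trace of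
  -- the value of the partial sum.
  refine eq_of_derivative_eq_mul (derivative_prod_of_logDeriv _ fun i _ =>
    derivative_prod_of_logDeriv _ fun u _ =>
      derivative_prod_evalSplitting p (padicIntToWitt p K) i (hY i u)) ?_ ?_
  · rw [derivative_map, derivative_binomialSeries, map_mul, map_mul, PowerSeries.map_C, h3]
    congr 1
    have h5 : PowerSeries.map (padicIntToWitt p K) (invOneAdd ℤ_[p]) =
        invOneAdd (WittVector p K) := by
      ext1 n
      simp [invOneAdd]
    rw [h5]
    simp only [map_sum, Finset.sum_mul]
  · have h6 : PowerSeries.constantCoeff (PowerSeries.map (padicIntToWitt p K)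
        (PowerSeries.binomialSeries ℤ_[p] (wittTrace p K ((partialHat p f l).eval₂
          (WittVector.map σ) (WittVector.teichmuller p y))))) = 1 := by
      rw [← PowerSeries.coeff_zero_eq_constantCoeff_apply, PowerSeries.coeff_map]
      simp
    rw [h6]
    simp [map_prod, constantCoeff_evalSplitting]

/-- The exponential sum over `K` attached to a polynomial over `W(F)`. -/
noncomputable def polyExpSum (g : Polynomial (WittVector p F)) : ℤ_[p]⟦X⟧ :=
  ∑ x ∈ Polynomial.nthRootsFinset (Nat.card K - 1) (1 : WittVector p K),
    PowerSeries.binomialSeries ℤ_[p] (wittTrace p K (g.eval₂ (WittVector.map σ) x))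

/-- The Dwork matrices of the conjugate splitting functions modulo `T ^ M`. -/
noncomputable def frobMatrix (l D M j : ℕ) :
    Matrix (Fin (D * M + 1)) (Fin (D * M + 1)) (WittVector p F)⟦X⟧ :=
  dworkMatrix p (D * M) (truncPoly M (D * M) (conjSplitting p f l j))

/-- The Dwork trace formula modulo `T ^ M`. -/
theorem X_pow_dvd_trace_sub_polyExpSum [Finite F] [Finite K] {a k : ℕ} (ha : 0 < a) (hk : 0 < k)
    (hF : Nat.card F = p ^ a) (hK : Nat.card K = p ^ (a * k)) {D : ℕ} (hD : 0 < D)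
    (hfD : ∀ i, (f i).natDegree ≤ D) (l M : ℕ) :
    (PowerSeries.X : (WittVector p F)⟦X⟧) ^ M ∣
      ((p ^ (a * k) - 1 : ℕ) : (WittVector p F)⟦X⟧) *
        (matProd (frobMatrix p f l D M) a ^ k).trace -
      PowerSeries.map (padicIntToWitt p F) (polyExpSum p σ (partialHat p f l)) := by
  let ρ : (WittVector p F)⟦X⟧ →+* (WittVector p K)⟦X⟧ := PowerSeries.map (WittVector.map σ)
  have hp1 : 1 ≤ p := hp.out.one_lt.le
  have hak : 0 < a * k := Nat.mul_pos ha hk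
  have hn : 0 < p ^ (a * k) - 1 := by
    have := Nat.one_lt_pow hak.ne' hp.out.one_lt
    omega
  let P : ℕ → Polynomial (WittVector p F)⟦X⟧ := fun j =>
    truncPoly M (D * M) (conjSplitting p f l j)
  have hP : ∀ j, (P j).natDegree ≤ (p - 1) * (D * M) := fun j =>
    (natDegree_truncPoly_le _ _ _).trans
      (Nat.le_mul_of_pos_left _ (by have := hp.out.one_lt; omega))
  -- The plain `T`-adic weight, in which every parameter has weight `1`, already gives the degree
  -- bound.
  have hdeg : ∀ j i, (PowerSeries.coeff i (conjSplitting p f l j)).natDegree ≤ D * i := fun j i =>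
    natDegree_le_of_mem_weightMonoid hD (conjSplitting_mem_weightMonoid p f
      (by exact_mod_cast hD) (e := fun _ => 1) (fun i => mem_filt_one (constantCoeff_param p i))
      (fun i => by simpa using hfD i) l j) i
  have hB : matProd (frobMatrix p f l D M) a ^ k =
      dworkMatrix (p ^ (a * k)) (D * M) (twistedProd p P (a * k)) := by
    rw [← matProd_mul_of_periodic, ← matProd_dworkMatrix hp1 hP]
    · rfl
    · intro j
      rw [frobMatrix, conjSplitting_add p f hF, frobMatrix]
  obtain ⟨g, hg⟩ := exists_isPrimitiveRoot_teichmuller p (L := K)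
  rw [hK] at hg
  have hsum := sum_eval_nthRootsFinset hn hg (PowerSeries.C (R := WittVector p K)) (L := D * M)
    (H := (twistedProd p P (a * k)).map ρ)
    (Polynomial.natDegree_map_le.trans (natDegree_twistedProd_le hp1 hP _))
  rw [Nat.sub_add_cancel (Nat.one_le_pow _ _ hp1), ← map_dworkMatrix, ← hB] at hsum
  -- The roots of unity live in `W(K)`, so the congruence is proved there and pulled back along the
  -- injection of `W(F)`.
  have key : (PowerSeries.X : (WittVector p K)⟦X⟧) ^ M ∣ ρ
      (((p ^ (a * k) - 1 : ℕ) : (WittVector p F)⟦X⟧) *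
        (matProd (frobMatrix p f l D M) a ^ k).trace -
      PowerSeries.map (padicIntToWitt p F) (polyExpSum p σ (partialHat p f l))) := by
    have e1 : ρ (matProd (frobMatrix p f l D M) a ^ k).trace =
        ((matProd (frobMatrix p f l D M) a ^ k).map ρ).trace := by
      simp [Matrix.trace]
    have e2 : ρ (PowerSeries.map (padicIntToWitt p F) (polyExpSum p σ (partialHat p f l))) =
        PowerSeries.map (padicIntToWitt p K) (polyExpSum p σ (partialHat p f l)) := by
      rw [← map_comp_padicIntToWitt p σ]
      ext1 n
      simp [ρ]
    rw [map_sub, map_mul, map_natCast, e1, ← hsum, e2, polyExpSum, map_sum, hK,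
      ← Finset.sum_sub_distrib]
    refine Finset.dvd_sum fun x hx => ?_
    rw [← hK] at hx
    obtain ⟨y, rfl⟩ := exists_teichmuller_eq_of_mem_nthRootsFinset p hx
    rw [← prod_map_conjSplitting p f σ hK, map_twistedProd, twistedProd, Polynomial.eval_prod]
    refine X_pow_dvd_prod_sub_prod _ fun j _ => ?_
    rw [Polynomial.expand_eval, ← map_pow]
    exact X_pow_dvd_eval_truncPoly_sub _ _ (hdeg j)
  rw [PowerSeries.X_pow_dvd_iff] at key ⊢
  intro m hm
  have h1 := key m hm
  rw [PowerSeries.coeff_map] at h1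
  exact (map_eq_zero_iff _ (WittVector.map_injective σ σ.injective)).1 h1

end TraceFormula

/-! ### Descent from `W(F)` to `ℤ_p` and comparison with `det (1 - s B)` -/

section Descent

variable (p : ℕ) [hp : Fact p.Prime] {F : Type*} [Field F] [CharP F p]

/-- The inclusion of `ℚ_p` in the fraction field of `W(F)`. -/
noncomputable def padicToFrac (F : Type*) [Field F] [CharP F p] :
    ℚ_[p] →+* FractionRing (WittVector p F) :=
  IsFractionRing.lift (A := ℤ_[p]) (K := ℚ_[p])
    (g := (algebraMap (WittVector p F) (FractionRing (WittVector p F))).comp (padicIntToWitt p F))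
    ((IsFractionRing.injective _ _).comp (padicIntToWitt_injective p F))

theorem padicToFrac_algebraMap (z : ℤ_[p]) :
    padicToFrac p F (algebraMap ℤ_[p] ℚ_[p] z) =
      algebraMap (WittVector p F) (FractionRing (WittVector p F)) (padicIntToWitt p F z) :=
  IsFractionRing.lift_algebraMap _ _

/-- An element of `ℚ_p` that is integral in the fraction field of `W(F)` is integral. -/
theorem exists_padicInt_of_integral {x : ℚ_[p]} {w : WittVector p F}
    (h : padicToFrac p F x = algebraMap _ _ w) : ∃ y : ℤ_[p], algebraMap ℤ_[p] ℚ_[p] y = x := by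
  by_contra hne
  have hx : 1 < ‖x‖ := by
    by_contra hx
    exact hne ⟨⟨x, not_lt.1 hx⟩, rfl⟩
  have hx0 : x ≠ 0 := by
    rintro rfl
    simp at hx
    linarith
  have hinv : ‖x⁻¹‖ < 1 := by
    rw [norm_inv]
    exact inv_lt_one_of_one_lt₀ hx
  -- If `x` is not integral, then `x⁻¹` is divisible by `p` in `ℤ_p`; as the image of `x` is
  -- integral, `p` would be a unit in `W(F)`.
  let y : ℤ_[p] := ⟨x⁻¹, hinv.le⟩
  have hy : ‖y‖ < 1 := hinv
  rw [← PadicInt.mem_nonunits, ← IsLocalRing.mem_maximalIdeal, PadicInt.maximalIdeal_eq_span_p,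
    Ideal.mem_span_singleton] at hy
  obtain ⟨t, ht⟩ := hy
  have h1 : padicToFrac p F (algebraMap ℤ_[p] ℚ_[p] y) * padicToFrac p F x = 1 := by
    rw [← map_mul]
    change padicToFrac p F (x⁻¹ * x) = 1
    rw [inv_mul_cancel₀ hx0, map_one]
  rw [padicToFrac_algebraMap, h, ← map_mul, ← map_one (algebraMap (WittVector p F) (FractionRing (WittVector p F)))] at h1
  have h2 := IsFractionRing.injective (WittVector p F) (FractionRing (WittVector p F)) h1
  rw [ht, map_mul, map_natCast, mul_assoc] at h2
  have h3 := congrArg (WittVector.constantCoeff (p := p)) h2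
  rw [map_mul, map_natCast, CharP.cast_eq_zero, zero_mul, map_one] at h3
  exact zero_ne_one h3

theorem exists_padicInt_pow_dvd_of_integral {x : ℚ_[p]} {w : WittVector p F} {c e : ℕ}
    (h : padicToFrac p F x = algebraMap _ _ w) (hw : (c : WittVector p F) ^ e ∣ w) :
    ∃ y : ℤ_[p], algebraMap ℤ_[p] ℚ_[p] ((c : ℤ_[p]) ^ e * y) = x := by
  obtain ⟨w', rfl⟩ := hw
  -- The value `c = 0` does occur, for the `T`-adic order.
  by_cases h0 : (c : ℚ_[p]) ^ e = 0
  · have h1 : (c : WittVector p F) ^ e = 0 := by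
      rw [← Nat.cast_pow, Nat.cast_eq_zero] at h0 ⊢
      exact h0
    rw [h1, zero_mul, map_zero, map_eq_zero] at h
    exact ⟨0, by simp [h]⟩
  · obtain ⟨y, hy⟩ := exists_padicInt_of_integral p (x := x / (c : ℚ_[p]) ^ e) (w := w') (by
      rw [map_div₀, h, map_mul, map_pow, map_natCast, map_pow, map_natCast,
        mul_div_cancel_left₀]
      rw [← Nat.cast_pow, Nat.cast_eq_zero] at h0
      rw [← Nat.cast_pow, Nat.cast_ne_zero]
      exact h0)
    refine ⟨y, ?_⟩
    rw [map_mul, hy, map_pow, map_natCast, mul_div_cancel₀ _ h0]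

/-- The logarithmic derivative of the characteristic series of a family of exponential sums. -/
noncomputable def sumLogDeriv (q : ℕ) (S : ℕ → ℤ_[p]⟦X⟧) : ℚ_[p]⟦X⟧⟦X⟧ :=
  PowerSeries.mk fun k => -(((q : ℚ_[p]) ^ (k + 1) - 1)⁻¹ •
    PowerSeries.map (algebraMap ℤ_[p] ℚ_[p]) (S (k + 1)))

theorem succ_mul_coeff_of_logDeriv {R : Type*} [CommRing R] {C l : R⟦X⟧} (h : d⁄dX R C = l * C)
    (n : ℕ) : ((n + 1 : ℕ) : R) * PowerSeries.coeff (n + 1) C =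
      ∑ ij ∈ Finset.HasAntidiagonal.antidiagonal n,
        PowerSeries.coeff ij.1 l * PowerSeries.coeff ij.2 C := by
  have := congrArg (PowerSeries.coeff n) h
  rw [PowerSeries.coeff_derivative, PowerSeries.coeff_mul] at this
  rw [← this]
  push_cast
  ring

/-- The coefficients of the characteristic series agree modulo `T ^ M` with those of
`det (1 - s B)` if the sums agree modulo `T ^ M` with the traces of the powers of `B`. -/
theorem X_pow_dvd_coeff_sub_charpolyRev {q : ℕ} (hq : 1 < q) {S : ℕ → ℤ_[p]⟦X⟧}
    {C : ℚ_[p]⟦X⟧⟦X⟧} (hC0 : PowerSeries.constantCoeff C = 1)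
    (hC : d⁄dX _ C = sumLogDeriv p q S * C) {ι : Type*} [Fintype ι] [DecidableEq ι] {M : ℕ}
    {B : Matrix ι ι (WittVector p F)⟦X⟧}
    (hB : ∀ k, 0 < k → PowerSeries.X ^ M ∣ ((q ^ k - 1 : ℕ) : (WittVector p F)⟦X⟧) * (B ^ k).trace -
      PowerSeries.map (padicIntToWitt p F) (S k)) (n : ℕ) :
    PowerSeries.X ^ M ∣ PowerSeries.map (padicToFrac p F) (PowerSeries.coeff n C) -
      PowerSeries.map (algebraMap (WittVector p F) (FractionRing (WittVector p F)))
        (B.charpolyRev.coeff n) := by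
  let Ω := FractionRing (WittVector p F)
  have : CharZero Ω := charZero_of_injective_algebraMap
    (IsFractionRing.injective (WittVector p F) Ω)
  let τ : ℚ_[p]⟦X⟧ →+* Ω⟦X⟧ := PowerSeries.map (padicToFrac p F)
  let κ : (WittVector p F)⟦X⟧ →+* Ω⟦X⟧ := PowerSeries.map (algebraMap (WittVector p F) Ω)
  let J : Ideal Ω⟦X⟧ := Ideal.span {PowerSeries.X ^ M}
  have hunit : ∀ m : ℕ, m ≠ 0 → IsUnit ((m : ℕ) : Ω⟦X⟧) := by
    intro m hm
    rw [PowerSeries.isUnit_iff_constantCoeff, map_natCast]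
    exact (Nat.cast_ne_zero.2 hm).isUnit
  -- Over the fraction field `q ^ (k + 1) - 1` is invertible, so the two logarithmic derivatives
  -- agree modulo `T ^ M`; the recursion for the coefficients then carries the congruence over.
  have hl : ∀ k, Ideal.Quotient.mk J (τ (PowerSeries.coeff k (sumLogDeriv p q S))) =
      Ideal.Quotient.mk J (κ (-(B ^ (k + 1)).trace)) := by
    intro k
    have hk : q ^ (k + 1) - 1 ≠ 0 := by
      have : 1 < q ^ (k + 1) := Nat.one_lt_pow (Nat.succ_ne_zero k) hq
      omega
    have hcast : (((q ^ (k + 1) - 1 : ℕ)) : ℚ_[p]) = (q : ℚ_[p]) ^ (k + 1) - 1 := by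
      rw [Nat.cast_sub (Nat.one_le_pow _ _ (by omega))]
      simp
    have e1 : ((q ^ (k + 1) - 1 : ℕ) : Ω⟦X⟧) * τ (PowerSeries.coeff k (sumLogDeriv p q S)) =
        - κ (PowerSeries.map (padicIntToWitt p F) (S (k + 1))) := by
      have e2 : ((q ^ (k + 1) - 1 : ℕ) : ℚ_[p]⟦X⟧) * PowerSeries.coeff k (sumLogDeriv p q S) =
          - PowerSeries.map (algebraMap ℤ_[p] ℚ_[p]) (S (k + 1)) := by
        rw [sumLogDeriv, PowerSeries.coeff_mk, ← hcast, PowerSeries.smul_eq_C_mul, mul_neg,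
          ← mul_assoc, ← map_natCast (PowerSeries.C (R := ℚ_[p])), ← map_mul,
          mul_inv_cancel₀ (Nat.cast_ne_zero.2 hk), map_one, one_mul]
      have e3 := congrArg τ e2
      rw [map_mul, map_natCast, map_neg] at e3
      rw [e3]
      congr 1
      ext1 j
      simp only [τ, κ, PowerSeries.coeff_map]
      exact padicToFrac_algebraMap p _
    have hd : PowerSeries.X ^ M ∣ ((q ^ (k + 1) - 1 : ℕ) : Ω⟦X⟧) * κ ((B ^ (k + 1)).trace) -
        κ (PowerSeries.map (padicIntToWitt p F) (S (k + 1))) := by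
      have := map_dvd κ (hB (k + 1) k.succ_pos)
      rw [map_sub, map_mul, map_natCast, map_pow, PowerSeries.map_X] at this
      exact this
    rw [Ideal.Quotient.eq, Ideal.mem_span_singleton]
    refine ((hunit _ hk).dvd_mul_left).1 ?_
    rw [mul_sub, e1, map_neg]
    convert (dvd_neg (α := Ω⟦X⟧)).2 (dvd_neg.2 hd) using 1
    ring
  rw [← Ideal.mem_span_singleton, ← Ideal.Quotient.eq]
  change Ideal.Quotient.mk J (τ _) = Ideal.Quotient.mk J (κ _)
  induction n using Nat.strong_induction_on with
  | _ n ih =>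
    rcases n with _ | n
    · have h0 : B.charpolyRev.coeff 0 = 1 := by
        rw [Polynomial.coeff_zero_eq_eval_zero, Matrix.eval_charpolyRev]
      rw [h0, PowerSeries.coeff_zero_eq_constantCoeff_apply, hC0, map_one, map_one, map_one, map_one]
    · have h1 := congrArg (fun z => Ideal.Quotient.mk J (τ z)) (succ_mul_coeff_of_logDeriv hC n)
      have h2 := congrArg (fun z => Ideal.Quotient.mk J (κ z))
        (succ_mul_coeff_of_logDeriv (derivative_charpolyRev B) n)
      simp only [map_mul, map_natCast, map_sum, Polynomial.coeff_coe] at h1 h2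
      have h3 : IsUnit (((n + 1 : ℕ) : Ω⟦X⟧ ⧸ J)) := by
        have := (hunit (n + 1) n.succ_ne_zero).map (Ideal.Quotient.mk J)
        rwa [map_natCast] at this
      refine h3.mul_left_cancel (h1.trans (Eq.trans ?_ h2.symm))
      refine Finset.sum_congr rfl fun ij hij => ?_
      have hij' := Finset.HasAntidiagonal.mem_antidiagonal.1 hij
      rw [hl, ih ij.2 (by omega)]
      simp

end Descent

/-! ### Passage from the partial sums to `f̂` -/

section Limit

variable (p : ℕ) [hp : Fact p.Prime]

open Filter Topology

/-- The coefficients of a series depend continuously on its logarithmic derivative. -/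
theorem tendsto_coeff_of_logDeriv {C : ℚ_[p]⟦X⟧⟦X⟧} {l : ℚ_[p]⟦X⟧⟦X⟧}
    {C' l' : ℕ → ℚ_[p]⟦X⟧⟦X⟧} (hC0 : PowerSeries.constantCoeff C = 1)
    (hC : d⁄dX _ C = l * C) (hC0' : ∀ n, PowerSeries.constantCoeff (C' n) = 1)
    (hC' : ∀ n, d⁄dX _ (C' n) = l' n * C' n)
    (hl : ∀ k j, Tendsto (fun n => PowerSeries.coeff j (PowerSeries.coeff k (l' n))) atTop
      (𝓝 (PowerSeries.coeff j (PowerSeries.coeff k l)))) (k j : ℕ) :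
    Tendsto (fun n => PowerSeries.coeff j (PowerSeries.coeff k (C' n))) atTop
      (𝓝 (PowerSeries.coeff j (PowerSeries.coeff k C))) := by
  induction k using Nat.strong_induction_on generalizing j with
  | _ k ih =>
    rcases k with _ | k
    · simp [hC0, hC0']
    · have hrec : ∀ {C l : ℚ_[p]⟦X⟧⟦X⟧}, d⁄dX _ C = l * C →
          PowerSeries.coeff j (PowerSeries.coeff (k + 1) C) = ((k + 1 : ℕ) : ℚ_[p])⁻¹ *
            ∑ ab ∈ Finset.HasAntidiagonal.antidiagonal k,
              ∑ cd ∈ Finset.HasAntidiagonal.antidiagonal j,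
                PowerSeries.coeff cd.1 (PowerSeries.coeff ab.1 l) *
                  PowerSeries.coeff cd.2 (PowerSeries.coeff ab.2 C) := by
        intro C l h
        have h1 := congrArg (PowerSeries.coeff j) (succ_mul_coeff_of_logDeriv h k)
        simp only [map_sum, PowerSeries.coeff_mul] at h1
        rw [← h1, ← PowerSeries.coeff_mul, ← map_natCast (PowerSeries.C (R := ℚ_[p])),
          PowerSeries.coeff_C_mul, inv_mul_cancel_left₀ (Nat.cast_ne_zero.2 k.succ_ne_zero)]
      rw [hrec hC]
      simp only [fun n => hrec (hC' n)]
      refine Tendsto.const_mul _ (tendsto_finsetSum _ fun ab hab => tendsto_finsetSum _ fun cd _ =>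
        (hl _ _).mul (ih ab.2 ?_ _))
      have := Finset.HasAntidiagonal.mem_antidiagonal.1 hab
      omega

/-- A coefficientwise limit of series in a step of the filtration lies in that step. -/
theorem exists_mem_filt_of_tendsto {c N K : ℕ} {b : ℚ_[p]⟦X⟧} {b' : ℕ → ℚ_[p]⟦X⟧}
    (hb' : ∀ n, ∃ y ∈ filt ℤ_[p] c N K, PowerSeries.map (algebraMap ℤ_[p] ℚ_[p]) y = b' n)
    (hlim : ∀ j, Tendsto (fun n => PowerSeries.coeff j (b' n)) atTop (𝓝 (PowerSeries.coeff j b))) :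
    ∃ y ∈ filt ℤ_[p] c N K, PowerSeries.map (algebraMap ℤ_[p] ℚ_[p]) y = b := by
  have h : ∀ j, ∃ y : ℤ_[p], algebraMap ℤ_[p] ℚ_[p] ((c : ℤ_[p]) ^ ((K - j) ⌈/⌉ N) * y) =
      PowerSeries.coeff j b := by
    intro j
    -- The multiples of a fixed power of `c` are a continuous image of the compact space `ℤ_p`.
    have hclosed : IsClosed (Set.range fun y : ℤ_[p] =>
        algebraMap ℤ_[p] ℚ_[p] ((c : ℤ_[p]) ^ ((K - j) ⌈/⌉ N) * y)) := by
      have hcont : Continuous fun y : ℤ_[p] => (((c : ℤ_[p]) ^ ((K - j) ⌈/⌉ N) * y : ℤ_[p]) : ℚ_[p]) :=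
        continuous_subtype_val.comp (continuous_const_mul _)
      exact (isCompact_range hcont).isClosed
    refine hclosed.mem_of_tendsto (hlim j) (Eventually.of_forall fun n => ?_)
    obtain ⟨y, hy, hyb⟩ := hb' n
    obtain ⟨t, ht⟩ := hy j
    exact ⟨t, by rw [← hyb, PowerSeries.coeff_map, ht]⟩
  choose y hy using h
  refine ⟨PowerSeries.mk fun j => (c : ℤ_[p]) ^ ((K - j) ⌈/⌉ N) * y j, fun j => ?_, ?_⟩
  · rw [PowerSeries.coeff_mk]
    exact dvd_mul_right _ _
  · ext1 j
    rw [PowerSeries.coeff_map, PowerSeries.coeff_mk, hy]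

/-- The trace is `ℤ_p`-linear, so it preserves divisibility by `p ^ n`. -/
theorem tendsto_wittTrace {K : Type*} [Field K] [CharP K p] {z : WittVector p K}
    {z' : ℕ → WittVector p K} (h : ∀ n, (p : WittVector p K) ^ n ∣ z - z' n) :
    Tendsto (fun n => wittTrace p K (z' n)) atTop (𝓝 (wittTrace p K z)) := by
  let : Algebra ℤ_[p] (WittVector p K) := (padicIntToWitt p K).toAlgebra
  choose w hw using h
  have h1 : ∀ n, wittTrace p K (z' n) = wittTrace p K z - (p : ℤ_[p]) ^ n * wittTrace p K (w n) := by
    intro n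
    have h2 : z' n = z - (p : ℤ_[p]) ^ n • w n := by
      have : (p : ℤ_[p]) ^ n • w n = (p : WittVector p K) ^ n * w n := by
        rw [Algebra.smul_def, map_pow, map_natCast]
      rw [this, ← hw]
      ring
    rw [h2]
    simp only [wittTrace]
    rw [map_sub, map_smul, smul_eq_mul]
  simp only [h1]
  have h3 : Tendsto (fun n => (p : ℤ_[p]) ^ n * wittTrace p K (w n)) atTop (𝓝 0) := by
    have hp1 : ‖(p : ℤ_[p])‖ < 1 := PadicInt.norm_natCast_lt_one_iff.2 dvd_rfl
    refine squeeze_zero_norm (a := fun n => ‖(p : ℤ_[p])‖ ^ n) (fun n => ?_)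
      (tendsto_pow_atTop_nhds_zero_of_lt_one (norm_nonneg _) hp1)
    rw [norm_mul, norm_pow]
    exact mul_le_of_le_one_right (by positivity) (PadicInt.norm_le_one _)
  simpa using tendsto_const_nhds.sub h3

variable {F : Type*} [Field F] [CharP F p]

theorem pow_dvd_eval₂_fHat_sub [PerfectRing F p] {f : ℕ → Polynomial F}
    (hf : BddAbove (Set.range fun i => (f i).natDegree)) {K : Type*} [Field K] [CharP K p]
    (σ : F →+* K) (x : WittVector p K) (l : ℕ) :
    (p : WittVector p K) ^ l ∣ (fHat p f).eval₂ (WittVector.map σ) x -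
      (partialHat p f l).eval₂ (WittVector.map σ) x := by
  have h1 : partialHat p f l = ∑ u ∈ Finset.range (maxDegree f + 1), Polynomial.monomial u
      (∑ i ∈ Finset.range l, (p : WittVector p F) ^ i *
        WittVector.teichmuller p ((f i).coeff u)) := by
    simp only [map_sum]
    rw [Finset.sum_comm, partialHat]
    refine Finset.sum_congr rfl fun i _ => Finset.sum_subset (Finset.range_mono ?_) fun u _ hu => ?_
    · exact Nat.succ_le_succ (le_ciSup hf i)
    · rw [Polynomial.coeff_eq_zero_of_natDegree_lt (by simpa using hu), WittVector.teichmuller_zero,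
        mul_zero, map_zero]
  rw [h1, fHat, Polynomial.eval₂_finsetSum, Polynomial.eval₂_finsetSum, ← Finset.sum_sub_distrib]
  refine Finset.dvd_sum fun u _ => ?_
  rw [Polynomial.eval₂_monomial, Polynomial.eval₂_monomial, ← sub_mul, ← map_sub]
  refine Dvd.dvd.mul_right ?_ _
  have := map_dvd (WittVector.map σ) (pow_dvd_teichmullerSeries_sub_sum p
    (fun i => (f i).coeff u) l)
  rwa [map_pow, map_natCast] at this

theorem tendsto_coeff_polyExpSum [PerfectRing F p] {f : ℕ → Polynomial F}
    (hf : BddAbove (Set.range fun i => (f i).natDegree)) {K : Type*} [Field K] [CharP K p]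
    (σ : F →+* K) (j : ℕ) :
    Tendsto (fun l => PowerSeries.coeff j (polyExpSum p σ (partialHat p f l))) atTop
      (𝓝 (PowerSeries.coeff j (polyExpSum p σ (fHat p f)))) := by
  simp only [polyExpSum, map_sum, PowerSeries.binomialSeries_coeff, smul_eq_mul, mul_one]
  refine tendsto_finsetSum _ fun x _ => ?_
  exact ((PadicInt.continuous_choose j).tendsto _).comp
    (tendsto_wittTrace p fun l => pow_dvd_eval₂_fHat_sub p hf σ x l)

end Limit

/-! ### The characteristic series and its coefficients -/

section CharSeries

variable (p : ℕ) [hp : Fact p.Prime] {F : Type*} [Field F] [Finite F] [CharP F p]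

/-- The exponential sums of a polynomial over the extensions of `F`. -/
noncomputable def expSumFamily (g : Polynomial (WittVector p F)) : ℕ → ℤ_[p]⟦X⟧
  | 0 => 0
  | k + 1 => polyExpSum p (algebraMap F (FiniteField.Extension F p (k + 1))) g

theorem expSum_eq_expSumFamily (f : ℕ → Polynomial F) (k : ℕ) :
    expSum p f (k + 1) = expSumFamily p (fHat p f) (k + 1) := by
  rw [expSum, expSumFamily, polyExpSum, FiniteField.natCard_extension]

theorem charSeries_logDeriv (f : ℕ → Polynomial F) :
    PowerSeries.constantCoeff (charSeries p f) = 1 ∧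
      d⁄dX _ (charSeries p f) =
        sumLogDeriv p (Nat.card F) (expSumFamily p (fHat p f)) * charSeries p f := by
  have h0 : PowerSeries.constantCoeff (logCharSeries p f) = 0 := by
    rw [← PowerSeries.coeff_zero_eq_constantCoeff_apply, logCharSeries, PowerSeries.coeff_mk]
  have hs := PowerSeries.HasSubst.of_constantCoeff_zero' h0
  -- `charSeries` substitutes into the exponential over `ℚ`; the chain rule is applied to the one
  -- over `ℚ_p⟦T⟧`.
  have hexp : charSeries p f = (PowerSeries.exp ℚ_[p]⟦X⟧).subst (logCharSeries p f) := by
    ext1 n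
    rw [charSeries, PowerSeries.coeff_subst' hs, PowerSeries.coeff_subst' hs]
    refine finsum_congr fun d => ?_
    rw [PowerSeries.coeff_exp, PowerSeries.coeff_exp]
    exact (algebraMap_smul ℚ_[p]⟦X⟧ _ _).symm
  have hd : d⁄dX _ (logCharSeries p f) =
      sumLogDeriv p (Nat.card F) (expSumFamily p (fHat p f)) := by
    ext1 k
    rw [PowerSeries.coeff_derivative, logCharSeries, PowerSeries.coeff_mk, sumLogDeriv,
      PowerSeries.coeff_mk]
    simp only
    rw [expSum_eq_expSumFamily, mul_inv, mul_comm (_⁻¹ : ℚ_[p]), neg_mul,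
      neg_inj, ← Nat.cast_succ, mul_comm, ← smul_smul, ← nsmul_eq_mul, ← Nat.cast_smul_eq_nsmul ℚ_[p],
      smul_smul, mul_inv_cancel₀ (Nat.cast_ne_zero.2 k.succ_ne_zero), one_smul]
  rw [hexp]
  refine ⟨constantCoeff_subst_eq_one (PowerSeries.constantCoeff_exp) h0, ?_⟩
  rw [PowerSeries.derivative_subst hs, PowerSeries.derivative_exp, hd, mul_comm]

/-- The bound for the characteristic series of a partial sum of `f̂`. -/
theorem exists_mem_filt_of_partialHat {a : ℕ} (ha : 0 < a) (hF : Nat.card F = p ^ a)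
    (f : ℕ → Polynomial F) {D : ℕ} (hD : 0 < D) (hfD : ∀ i, (f i).natDegree ≤ D) {c N : ℕ} {δ : ℝ}
    (hδ : 0 < δ) {e : ℕ → ℕ} (he : ∀ i, param p ℤ_[p] i ∈ filt ℤ_[p] c N (e i))
    (hd : ∀ i, ((f i).natDegree : ℝ) ≤ δ * e i) (l : ℕ) {C : ℚ_[p]⟦X⟧⟦X⟧}
    (hC0 : PowerSeries.constantCoeff C = 1)
    (hC : d⁄dX _ C = sumLogDeriv p (Nat.card F) (expSumFamily p (partialHat p f l)) * C) (n : ℕ) :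
    ∃ y ∈ filt ℤ_[p] c N ⌈((a : ℝ) * ((p : ℝ) - 1) * (n : ℝ) * ((n : ℝ) - 1)) / (2 * δ)⌉₊,
      PowerSeries.map (algebraMap ℤ_[p] ℚ_[p]) y = PowerSeries.coeff n C := by
  set K : ℕ := ⌈((a : ℝ) * ((p : ℝ) - 1) * (n : ℝ) * ((n : ℝ) - 1)) / (2 * δ)⌉₊
  have h : ∀ j, ∃ y : ℤ_[p], algebraMap ℤ_[p] ℚ_[p] ((c : ℤ_[p]) ^ ((K - j) ⌈/⌉ N) * y) =
      PowerSeries.coeff j (PowerSeries.coeff n C) := by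
    intro j
    -- The coefficient of `T ^ j` needs precision `T ^ (j + 1)` only, so the matrix and its size may
    -- depend on `j`.
    let B := matProd (frobMatrix p f l D (j + 1)) a
    have hB : ∀ k, 0 < k → PowerSeries.X ^ (j + 1) ∣
        ((Nat.card F ^ k - 1 : ℕ) : (WittVector p F)⟦X⟧) * (B ^ k).trace -
          PowerSeries.map (padicIntToWitt p F) (expSumFamily p (partialHat p f l) k) := by
      intro k hk
      obtain ⟨k, rfl⟩ : ∃ k', k = k' + 1 := ⟨k - 1, by omega⟩
      rw [hF, ← pow_mul]
      refine X_pow_dvd_trace_sub_polyExpSum p f _ ha hk hF ?_ hD hfD l (j + 1)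
      rw [FiniteField.natCard_extension, hF, ← pow_mul]
    have h1 := X_pow_dvd_coeff_sub_charpolyRev p Finite.one_lt_card hC0 hC hB n
    rw [PowerSeries.X_pow_dvd_iff] at h1
    have h2 := h1 j (Nat.lt_succ_self j)
    rw [map_sub, sub_eq_zero, PowerSeries.coeff_map, PowerSeries.coeff_map] at h2
    refine exists_padicInt_pow_dvd_of_integral p h2 ?_
    exact coeff_charpolyRev_matProd_mem_filt Fin.val_injective hp.out.one_lt.le hδ
      (fun i u v => dworkMatrix_truncPoly_mem_filt
        (conjSplitting_mem_weightMonoid p f hδ he hd l i) _ _ _ _ u v) ha n j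
  choose y hy using h
  refine ⟨PowerSeries.mk fun j => (c : ℤ_[p]) ^ ((K - j) ⌈/⌉ N) * y j, fun j => ?_, ?_⟩
  · rw [PowerSeries.coeff_mk]
    exact dvd_mul_right _ _
  · ext1 j
    rw [PowerSeries.coeff_map, PowerSeries.coeff_mk, hy]

theorem exists_mem_filt_charSeries {a : ℕ} (ha : 0 < a) (hF : Nat.card F = p ^ a)
    (f : ℕ → Polynomial F) (hf : BddAbove (Set.range fun i => (f i).natDegree))
    {c N : ℕ} {δ : ℝ} (hδ : 0 < δ) {e : ℕ → ℕ}
    (he : ∀ i, param p ℤ_[p] i ∈ filt ℤ_[p] c N (e i))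
    (hd : ∀ i, ((f i).natDegree : ℝ) ≤ δ * e i) (n : ℕ) :
    ∃ y ∈ filt ℤ_[p] c N ⌈((a : ℝ) * ((p : ℝ) - 1) * (n : ℝ) * ((n : ℝ) - 1)) / (2 * δ)⌉₊,
      PowerSeries.map (algebraMap ℤ_[p] ℚ_[p]) y = PowerSeries.coeff n (charSeries p f) := by
  obtain ⟨hC0, hC⟩ := charSeries_logDeriv p f
  choose C' hC0' hC' using fun l => exists_derivative_eq_mul
    (sumLogDeriv p (Nat.card F) (expSumFamily p (partialHat p f l)))
  have hfD : ∀ i, (f i).natDegree ≤ maxDegree f + 1 := fun i =>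
    (le_ciSup hf i).trans (Nat.le_succ _)
  refine exists_mem_filt_of_tendsto p (b' := fun l => PowerSeries.coeff n (C' l)) (fun l =>
    exists_mem_filt_of_partialHat p ha hF f (Nat.succ_pos _) hfD hδ he hd l (hC0' l) (hC' l) n)
    fun j => tendsto_coeff_of_logDeriv p hC0 hC hC0' hC' (fun k j => ?_) n j
  simp only [sumLogDeriv, PowerSeries.coeff_mk, map_neg, PowerSeries.coeff_smul,
    PowerSeries.coeff_map, smul_eq_mul]
  refine (Filter.Tendsto.const_mul _ ?_).neg
  exact (continuous_subtype_val.tendsto _).comp (tendsto_coeff_polyExpSum p hf _ j)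

end CharSeries

/-! ### From the filtration to the order -/

section Order

theorem le_adicOrder {A : Type*} [CommRing A] {I : Ideal A} {x : A} {m : ℕ} (h : x ∈ I ^ m) :
    (m : ℕ∞) ≤ adicOrder I x :=
  le_iSup₂_of_le m h le_rfl

variable (p : ℕ) [hp : Fact p.Prime]

theorem le_ordR_one {K : ℕ} {b : ℤ_[p]⟦X⟧} (hb : b ∈ filt ℤ_[p] 0 1 K) :
    (K : ℕ∞) ≤ ordR p 1 b := by
  rw [ordR, if_pos rfl]
  refine le_adicOrder ?_
  rw [Ideal.span_singleton_pow, Ideal.mem_span_singleton, PowerSeries.X_pow_dvd_iff]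
  intro j hj
  have := hb j
  rwa [ceilDiv_one, Nat.cast_zero, zero_pow (by omega), zero_dvd_iff] at this

/-- With `ϖ ^ N = p`, the coefficient `b_j` is divisible by `ϖ ^ (K - j)`, so `b_j T ^ j` lies in
`(ϖ, T) ^ K` for `j < K`; the remaining tail is divisible by `T ^ K`. -/
theorem le_ordR_add_two (m : ℕ) {K : ℕ} {b : ℤ_[p]⟦X⟧}
    (hb : b ∈ filt ℤ_[p] p (p ^ m * (p - 1)) K) : (K : ℕ∞) ≤ ordR p (m + 2) b := by
  rw [ordR, if_neg (by omega), Nat.add_sub_cancel]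
  set N := p ^ m * (p - 1)
  have hN : 0 < N := Nat.mul_pos (pow_pos hp.out.pos _) (by have := hp.out.one_lt; omega)
  refine le_adicOrder ?_
  set ϖ := AdjoinRoot.root (Polynomial.X ^ N - Polynomial.C (p : ℤ_[p]))
  set I : Ideal (PadicIntRoot p N)⟦X⟧ := Ideal.span {PowerSeries.C ϖ, PowerSeries.X}
  have hϖ : ϖ ^ N = (p : PadicIntRoot p N) := by
    have := AdjoinRoot.eval₂_root (Polynomial.X ^ N - Polynomial.C (p : ℤ_[p]))
    simpa [sub_eq_zero] using this
  have hpϖ : algebraMap ℤ_[p] (PadicIntRoot p N) (p : ℤ_[p]) = ϖ ^ N :=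
    (map_natCast _ _).trans hϖ.symm
  have hϖI : PowerSeries.C ϖ ∈ I := Ideal.subset_span (by simp)
  have hXI : (PowerSeries.X : (PadicIntRoot p N)⟦X⟧) ∈ I := Ideal.subset_span (by simp)
  set B := PowerSeries.map (algebraMap ℤ_[p] (PadicIntRoot p N)) b
  have hterm : ∀ j < K, PowerSeries.C (PowerSeries.coeff j B) * PowerSeries.X ^ j ∈ I ^ K := by
    intro j hj
    obtain ⟨t, ht⟩ := map_dvd (algebraMap ℤ_[p] (PadicIntRoot p N)) (hb j)
    rw [map_pow, hpϖ, ← pow_mul] at ht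
    rw [PowerSeries.coeff_map, ht, map_mul, map_pow]
    have h1 := (ceilDiv_le_iff_le_mul hN (b := K - j)).1 le_rfl
    have h2 : PowerSeries.C ϖ ^ (N * ((K - j) ⌈/⌉ N)) * PowerSeries.C t ∈ I ^ (K - j) :=
      Ideal.mul_mem_right _ _ (Ideal.pow_le_pow_right h1 (Ideal.pow_mem_pow hϖI _))
    have h3 := Ideal.mul_mem_mul h2 (Ideal.pow_mem_pow hXI j)
    rwa [← pow_add, Nat.sub_add_cancel hj.le] at h3
  obtain ⟨t, ht⟩ : PowerSeries.X ^ K ∣ B - ((PowerSeries.trunc K B : Polynomial _) :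
      (PadicIntRoot p N)⟦X⟧) := by
    rw [PowerSeries.X_pow_dvd_iff]
    intro j hj
    rw [map_sub, Polynomial.coeff_coe, PowerSeries.coeff_trunc, if_pos hj, sub_self]
  rw [← sub_add_cancel B ((PowerSeries.trunc K B : Polynomial _) : (PadicIntRoot p N)⟦X⟧), ht]
  refine Ideal.add_mem _ (Ideal.mul_mem_right _ _ (Ideal.pow_mem_pow hXI K)) ?_
  rw [PowerSeries.trunc_apply, ← Polynomial.coeToPowerSeries.ringHom_apply, map_sum]
  refine Ideal.sum_mem _ fun j hj => ?_
  have h4 := hterm j (by simpa using hj)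
  rw [← Polynomial.C_mul_X_pow_eq_monomial]
  simpa using h4

end Order

/-! ### Degrees and `δ` -/

section Degrees

variable (p : ℕ) [hp : Fact p.Prime] {F : Type*} [Field F] {f : ℕ → Polynomial F}

theorem bddAbove_natDegree_div (hf : BddAbove (Set.range fun i => (f i).natDegree)) :
    BddAbove (Set.range fun i : ℕ => ((f i).natDegree : ℝ) / (p : ℝ) ^ i) := by
  obtain ⟨D, hD⟩ := hf
  refine ⟨D, ?_⟩
  rintro _ ⟨i, rfl⟩
  have h1 : ((f i).natDegree : ℝ) ≤ D := by exact_mod_cast hD ⟨i, rfl⟩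
  have h2 : (1 : ℝ) ≤ (p : ℝ) ^ i := one_le_pow₀ (by exact_mod_cast hp.out.one_lt.le)
  exact (div_le_self (Nat.cast_nonneg _) h2).trans h1

theorem natDegree_le_delta_mul (hf : BddAbove (Set.range fun i => (f i).natDegree)) (i : ℕ) :
    ((f i).natDegree : ℝ) ≤ delta p f * (p : ℝ) ^ i := by
  have hp0 : (0 : ℝ) < (p : ℝ) ^ i := pow_pos (by exact_mod_cast hp.out.pos) i
  rw [← div_le_iff₀ hp0]
  exact le_ciSup (bddAbove_natDegree_div p hf) i

theorem delta_pos (hf₀ : 0 < (f 0).natDegree)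
    (hf : BddAbove (Set.range fun i => (f i).natDegree)) : 0 < delta p f := by
  have h := natDegree_le_delta_mul p hf 0
  rw [pow_zero, mul_one] at h
  exact lt_of_lt_of_le (by exact_mod_cast hf₀) h

/-- The maximal degree is attained at index `m`, so beyond `m` every degree is at most `d_m ≤ δ p ^
m`. -/
theorem natDegree_le_delta_mul_min (hf : BddAbove (Set.range fun i => (f i).natDegree)) {m : ℕ}
    (hm : mTilde f = m + 1) (i : ℕ) :
    ((f i).natDegree : ℝ) ≤ delta p f * (p ^ min i m : ℕ) := by
  push_cast
  rcases le_total i m with h | h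
  · rw [min_eq_left h]
    exact natDegree_le_delta_mul p hf i
  · rw [min_eq_right h]
    have hne : {i | (f i).natDegree = maxDegree f}.Nonempty := Nat.sSup_mem (Set.range_nonempty _) hf
    have h1 : (f m).natDegree = maxDegree f := by
      have h2 := Nat.sInf_mem hne
      have h3 : sInf {i | (f i).natDegree = maxDegree f} = m := by
        rw [mTilde] at hm
        omega
      rwa [h3] at h2
    refine le_trans ?_ (natDegree_le_delta_mul p hf m)
    rw [h1]
    exact_mod_cast le_ciSup hf i

end Degrees

end WittTower

/-! ### The main theorem -/

theorem theorem6 (p : ℕ) [Fact p.Prime] (a : ℕ) (ha : 0 < a)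
    (F : Type*) [Field F] [Finite F] [CharP F p] (hF : Nat.card F = p ^ a)
    (f : ℕ → Polynomial F) (hf₀ : 0 < (f 0).natDegree)
    (hf : BddAbove (Set.range fun i => (f i).natDegree)) :
    ∃ C : ℤ_[p]⟦X⟧⟦X⟧,
      PowerSeries.map (PowerSeries.map (algebraMap ℤ_[p] ℚ_[p])) C = WittTower.charSeries p f ∧
      ∀ n : ℕ,
        ENNReal.ofReal (((a : ℝ) * ((p : ℝ) - 1) * (n : ℝ) * ((n : ℝ) - 1)) /
            (2 * WittTower.delta p f)) ≤
          ((WittTower.ordR p (WittTower.mTilde f) (PowerSeries.coeff n C) : ℕ∞) : ℝ≥0∞) := by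
  have hδ := WittTower.delta_pos p hf₀ hf
  have main : ∀ n : ℕ, ∃ y : ℤ_[p]⟦X⟧,
      (⌈((a : ℝ) * ((p : ℝ) - 1) * (n : ℝ) * ((n : ℝ) - 1)) / (2 * WittTower.delta p f)⌉₊ : ℕ∞) ≤
        WittTower.ordR p (WittTower.mTilde f) y ∧
      PowerSeries.map (algebraMap ℤ_[p] ℚ_[p]) y =
        PowerSeries.coeff n (WittTower.charSeries p f) := by
    intro n
    obtain ⟨m, hm⟩ : ∃ m, WittTower.mTilde f = m + 1 := ⟨_, add_comm _ _⟩
    have hd := WittTower.natDegree_le_delta_mul_min p hf hm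
    rw [hm]
    rcases m with _ | m
    -- For `c = 0`, `N = 1`, divisibility by `0 ^ (K - j)` means vanishing for `j < K` and is no
    -- condition for `j ≥ K`, so the filtration is by powers of `T`.
    · obtain ⟨y, hy, hyC⟩ := WittTower.exists_mem_filt_charSeries p ha hF f hf hδ
        (c := 0) (N := 1) (e := fun i => p ^ min i 0)
        (fun i => by simpa using WittTower.mem_filt_one (WittTower.constantCoeff_param p i)) hd n
      exact ⟨y, WittTower.le_ordR_one p hy, hyC⟩
    · obtain ⟨y, hy, hyC⟩ := WittTower.exists_mem_filt_charSeries p ha hF f hf hδ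
        (fun i => WittTower.param_mem_filt p m i) hd n
      exact ⟨y, WittTower.le_ordR_add_two p m hy, hyC⟩
  choose y hy hyC using main
  refine ⟨PowerSeries.mk y, ?_, fun n => ?_⟩
  · ext1 n
    rw [PowerSeries.coeff_map, PowerSeries.coeff_mk, hyC]
  · rw [PowerSeries.coeff_mk]
    refine (ENNReal.ofReal_le_ofReal (Nat.le_ceil _)).trans ?_
    rw [ENNReal.ofReal_natCast]
    exact_mod_cast ENat.toENNReal_le.2 (hy n)
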